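/- **Setting.** Let $U$ and $X$ be real Banach spaces, with $U\subset X$ a subspace carrying its own complete norm for which the inclusion is continuous, such that $X=U\oplus N_{p^*}$ with $N_{p^*}=\mathrm{span}\{p_1^*,\dots,p_{N_0}^*\}$. Let $p_1,\dots,p_{N_0}\in X'$ vanish on $U$ and satisfy $\langle p^*_m,p_n\rangle=\delta_{m,n}$, and put $N_p=\mathrm{span}\{p_n\}$. The dual $U'$ of $U$ is identified with $\{s\in X': \langle p_n^*,s\rangle=0 \text{ for all } n\}$ (extension of functionals by $0$ on $N_{p^*}$), so that $X'=U'\oplus N_p$; for $f\in X'$ let $\|f\|_{U'}$ be the dual norm of the $U'$-component of $f$, a semi-norm on $X'$ with null space $N_p$. Let $\nu_1,\dots,\nu_M\in X$ be linearly independent, $M>N_0$, $N_\nu=\mathrm{span}\{\nu_m\}$, and $\boldsymbol\nu(f)=(\langle\nu_1,f\rangle,\dots,\langle\nu_M,f\rangle)$ for $f\in X'$. Assume that the vectors $\mathbf v_n=\boldsymbol\nu(p_n)\in\mathbb R^M$, $n=1,\dots,N_0$, are linearly independent, and let $\mathbf u_1,\dots,\mathbf u_{M-N_0}\in\mathbb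 R^M$ be such that $\mathbb R^M=\mathrm{span}\{\mathbf v_n\}\oplus\mathrm{span}\{\mathbf u_m\}$. Let $E:\mathbb R^M\times\mathbb R^M\to[0,+\infty]$ and $\mathbf y\in\mathbb R^M$ be such that $E(\mathbf y,\cdot)$ is proper, lower semicontinuous, convex and coercive ($E(\mathbf y,\mathbf z)\to\infty$ as $\|\mathbf z\|\to\infty$). Let $\psi:[0,\infty)\to[0,\infty)$ be strictly increasing and convex. For $u\in U$ write $J(u)=\{s\in U':\|s\|_{U'}=\|u\|_U,\ \langle u,s\rangle=\|u\|_U\|s\|_{U'}\}$ for the set of its $(U',U)$-conjugates. **Claim.** The solution set $$S=\arg\min_{f\in X'}\big(E(\mathbf y,\boldsymbol\nu(f))+\psi(\|f\|_{U'})\big)$$ is nonempty, convex and weak*-compact. There are unique vectors $\widetilde{\mathbf u}_1,\dots,\widetilde{\mathbf u}_{M-N_0}\in\mathbb R^M$ with $\widetilde{\mathbf u}_m^T\mathbf v_n=0$ and $\widetilde{\mathbf u}_m^T\mathbf u_{m'}=\delta_{m,m'}$, and the elements $\widetilde\nu_m=\sum_{j=1}^M[\widetilde{\mathbf u}_m]_j\,\nu_j$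 lie in $U$ and are linearly independent. Suppose in addition that $E(\mathbf y,\cdot)$ is strictly convex (on the set where it is finite), or that it imposes the equality constraint $\boldsymbol\nu(f)=\mathbf y$ ($E(\mathbf y,\mathbf z)=+\infty$ for $\mathbf z\ne\mathbf y$). Then there is $\mathbf a\in\mathbb R^{M-N_0}$ such that, with $\widetilde\nu_0=\sum_{m=1}^{M-N_0}a_m\widetilde\nu_m\in N_\nu\cap U$, every $f_0\in S$ has a unique decomposition $f_0=p_0+s_0$ with $p_0\in N_p$ and $s_0\in U'$, and $s_0\in J(\widetilde\nu_0)$ ($\widetilde\nu_0$ being common to all solutions). Moreover: * If $U'$ is a Hilbert space and $\psi$ is strictly convex, the solution is unique and $f_0=\sum_{m=1}^{M-N_0}a_m\varphi_m+\sum_{n=1}^{N_0}b_np_n$ for some $\mathbf b\in\mathbb R^{N_0}$, where $\varphi_m\in U'$ is the image of $\widetilde\nu_m$ under the Riesz map $U\to U'$. * If $U'$ is strictly convex, then $J$ is single-valued, $J(u)=\{\mathrm J_U\{u\}\}$, the solution is unique, and $f_0=\mathrm J_U\big\{\sum_{m=1}^{M-N_0}a_m\widetilde\nu_m\big\}+\sum_{n=1}^{N_0}b_np_n$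 for some $\mathbf b\in\mathbb R^{N_0}$. * In all cases (in particular when $U'$ is not strictly convex), $S$ is the weak*-closure of the convex hull of its extreme points, and every extreme point of $S$ can be written as $f_0=\sum_{k=1}^{K_0}c_ke_k+\sum_{n=1}^{N_0}b_np_n$ with $K_0\le M-N_0$, $c_k,b_n\in\mathbb R$, and $e_1,\dots,e_{K_0}$ extreme points of the unit ball of $U'$. * If $E(\mathbf y,\cdot)$ is strictly convex and $N_{p^*}\subset N_\nu$, there is a unique $\mathbf b\in\mathbb R^{N_0}$ such that every $f_0\in S$ has null-space component $p_0=\sum_{n=1}^{N_0}b_np_n$. -/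

import Mathlib

open scoped NNReal ENNReal Topology

namespace SemiNormRep

/-- The `(U', U)`-duality mapping `J(u)`: all functionals `s` in the dual `U'` with
`‖s‖ = ‖u‖` and `⟨u, s⟩ = ‖u‖ ‖s‖`. -/
def dualityMap {U : Type*} [NormedAddCommGroup U] [NormedSpace ℝ U] (u : U) :
    Set (StrongDual ℝ U) :=
  {s | ‖s‖ = ‖u‖ ∧ s u = ‖u‖ * ‖s‖}

/-- `J` is the duality operator of `U`: the duality mapping is single-valued, with value `J u`. -/
def IsDualityOperator {U : Type*} [NormedAddCommGroup U] [NormedSpace ℝ U]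
    (J : U → StrongDual ℝ U) : Prop :=
  ∀ u, dualityMap u = {J u}

/-- `R` is the Riesz map `u ↦ ⟪u, ·⟫` of the Hilbert space `U`; the inner product is written
through the norm by polarization. -/
def IsRieszMap {U : Type*} [NormedAddCommGroup U] [NormedSpace ℝ U]
    (R : U ≃ₗᵢ[ℝ] StrongDual ℝ U) : Prop :=
  ∀ u v, R u v = (‖u + v‖ ^ 2 - ‖u - v‖ ^ 2) / 4

/-- A dual pair `X = U ⊕ N_{p*}`, `X' = U' ⊕ N_p`. The Banach space `U` carries its own norm and is
continuously embedded in `X`; `N_{p*}` is spanned by `p*_1, …, p*_{N₀}`, and `N_p`, the dual of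
`N_{p*}`, by the biorthonormal functionals `p_1, …, p_{N₀}`, which vanish on `U`. -/
structure SplitPair (X U : Type*) [NormedAddCommGroup X] [NormedSpace ℝ X]
    [NormedAddCommGroup U] [NormedSpace ℝ U] (N₀ : ℕ) where
  /-- the inclusion `U ⊆ X` -/
  incl : U →L[ℝ] X
  incl_injective : Function.Injective incl
  /-- the basis of the null space `N_p ⊆ X'` -/
  p : Fin N₀ → StrongDual ℝ X
  /-- the biorthonormal basis of `N_{p*} ⊆ X` -/
  pstar : Fin N₀ → X
  isCompl : IsCompl incl.range (Submodule.span ℝ (Set.range pstar))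
  biorthonormal : ∀ m n, p n (pstar m) = if m = n then 1 else 0
  p_incl : ∀ n u, p n (incl u) = 0

namespace SplitPair

variable {X U : Type*} [NormedAddCommGroup X] [NormedSpace ℝ X] [NormedAddCommGroup U]
  [NormedSpace ℝ U] {N₀ : ℕ}

/-- The null space `N_p = span {p_n} ⊆ X'`. -/
def nullSpace (D : SplitPair X U N₀) : Submodule ℝ (StrongDual ℝ X) :=
  Submodule.span ℝ (Set.range D.p)

/-- The projector `X' → U'`. As an element of the dual of `U`, the `U'`-component of `f` is the
restriction of `f` to `U`, because `N_p` vanishes on `U`. -/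
def dualProj (D : SplitPair X U N₀) (f : StrongDual ℝ X) : StrongDual ℝ U :=
  f.comp D.incl

/-- The semi-norm `‖f‖_{U'} = ‖Proj_{U'} f‖_{U'}` on `X'`. -/
noncomputable def semiNorm (D : SplitPair X U N₀) (f : StrongDual ℝ X) : ℝ≥0 :=
  ‖D.dualProj f‖₊

/-- The projector `X → U` along `N_{p*}`. -/
noncomputable def proj [CompleteSpace X] [CompleteSpace U] (D : SplitPair X U N₀) : X →L[ℝ] U :=
  haveI : FiniteDimensional ℝ (Submodule.span ℝ (Set.range D.pstar)) :=
    FiniteDimensional.span_of_finite ℝ (Set.finite_range D.pstar)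
  haveI : CompleteSpace (Submodule.span ℝ (Set.range D.pstar)) := FiniteDimensional.complete ℝ _
  (ContinuousLinearMap.fst ℝ U (Submodule.span ℝ (Set.range D.pstar))).comp
    (D.incl.coprodSubtypeLEquivOfIsCompl D.isCompl
      (LinearMap.ker_eq_bot.2 D.incl_injective)).symm.toContinuousLinearMap

/-- The inclusion `U' ⊆ X'`: a functional on `U` is extended by `0` on `N_{p*}`. -/
noncomputable def dualIncl [CompleteSpace X] [CompleteSpace U] (D : SplitPair X U N₀)
    (s : StrongDual ℝ U) : StrongDual ℝ X :=
  s.comp D.proj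

end SplitPair

/-- The measurement operator `f ↦ (⟨ν_1, f⟩, …, ⟨ν_M, f⟩)`. -/
def measure {X : Type*} [NormedAddCommGroup X] [NormedSpace ℝ X] {M : ℕ} (ν : Fin M → X)
    (f : StrongDual ℝ X) : Fin M → ℝ :=
  fun m => f (ν m)

/-- The vectors `v_n ∈ ℝ^M` with `[v_n]_m = ⟨ν_m, p_n⟩`. -/
def crossVec {X U : Type*} [NormedAddCommGroup X] [NormedSpace ℝ X] [NormedAddCommGroup U]
    [NormedSpace ℝ U] {N₀ M : ℕ} (D : SplitPair X U N₀) (ν : Fin M → X) :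
    Fin N₀ → Fin M → ℝ :=
  fun n => measure ν (D.p n)

/-- `w` is biorthogonal to `u` and orthogonal to `v`: `w_mᵀ v_n = 0` and `w_mᵀ u_{m'} = δ_{m,m'}`. -/
def IsBiorthogonal {M N₀ K : ℕ} (v : Fin N₀ → Fin M → ℝ) (u w : Fin K → Fin M → ℝ) : Prop :=
  (∀ m n, w m ⬝ᵥ v n = 0) ∧ ∀ m m', w m ⬝ᵥ u m' = if m = m' then 1 else 0

/-- The functional `E(y, ν(f)) + ψ(‖f‖_{U'})`, with values in `[0, ∞]`. -/
noncomputable def objective {X U : Type*} [NormedAddCommGroup X] [NormedSpace ℝ X]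
    [NormedAddCommGroup U] [NormedSpace ℝ U] {N₀ M : ℕ} (D : SplitPair X U N₀) (ν : Fin M → X)
    (E : (Fin M → ℝ) → (Fin M → ℝ) → ℝ≥0∞) (ψ : ℝ≥0 → ℝ≥0) (y : Fin M → ℝ)
    (f : StrongDual ℝ X) : ℝ≥0∞ :=
  E y (measure ν f) + (ψ (D.semiNorm f) : ℝ≥0∞)

/-- The set of all minimizers over `X'`. -/
def solutionSet {X U : Type*} [NormedAddCommGroup X] [NormedSpace ℝ X]
    [NormedAddCommGroup U] [NormedSpace ℝ U] {N₀ M : ℕ} (D : SplitPair X U N₀) (ν : Fin M → X)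
    (E : (Fin M → ℝ) → (Fin M → ℝ) → ℝ≥0∞) (ψ : ℝ≥0 → ℝ≥0) (y : Fin M → ℝ) :
    Set (StrongDual ℝ X) :=
  {f | ∀ g, objective D ν E ψ y f ≤ objective D ν E ψ y g}

/-- Strict convexity of a `[0, ∞]`-valued function: strict inequality between any two distinct
points at which the function is finite. -/
def ExtStrictConvex {M : ℕ} (F : (Fin M → ℝ) → ℝ≥0∞) : Prop :=
  StrictConvexOn ℝ≥0 {z | F z ≠ ⊤} F

end SemiNormRep

/-
The sublevel sets of the objective are weak*-closed, and bounded because `f` is controlled by its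
`U'`-component together with `ν(f)` (the `v_n` are independent); Banach–Alaoglu makes them compact,
which gives existence. If `E(y, ·)` is strictly convex or forces `ν(f) = y`, then `ν(f)` is the
same for all solutions. Since every functional on `U` with the values of a solution at the `ν'_m`
lifts to some `f` with the same `ν(f)`, the `U'`-components of the solutions are exactly the
functionals of least norm with prescribed values at the `ν'_m`. By Hahn–Banach on `span {ν'_m}`
such a functional lies in `J(u₀)` for some `u₀` in that span, and then so do all the others.

For the extreme points, `J(u₀)` is an exposed face of a ball. At an extreme solution the `ν'_m`
separate the directions in which this face can be followed both ways, and all these directions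
vanish at `u₀`; so, unless `u₀ = 0`, the minimal face has dimension less than `M - N₀`, and
Carathéodory's theorem applied inside it bounds the number of extreme points of the ball needed.
-/

namespace SemiNormRep

/-! ### Faces and extreme points of convex sets -/

section Faces

variable {V : Type*} [AddCommGroup V] [Module ℝ V] {F : Set V} {x z d : V}

/-- The linear span of the smallest face of `F` that contains `x`, translated to the origin: the
directions in which one can move both forwards and backwards from `x` without leaving `F`. -/
def faceDirection (hF : Convex ℝ F) (hx : x ∈ F) : Submodule ℝ V where
  carrier := {d | ∀ᶠ t in 𝓝 (0 : ℝ), x + t • d ∈ F}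
  zero_mem' := by simp [hx]
  add_mem' {d₁ d₂} h₁ h₂ := by
    have hdouble : Filter.Tendsto (fun t : ℝ => 2 * t) (𝓝 0) (𝓝 0) :=
      Continuous.tendsto' (by fun_prop) _ _ (by simp)
    filter_upwards [hdouble.eventually h₁, hdouble.eventually h₂] with t ht₁ ht₂
    convert hF.midpoint_mem ht₁ ht₂ using 1
    rw [midpoint_eq_smul_add, invOf_eq_inv]
    module
  smul_mem' c d hd := by
    have hscale : Filter.Tendsto (fun t : ℝ => t * c) (𝓝 0) (𝓝 0) :=
      Continuous.tendsto' (by fun_prop) _ _ (by simp)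
    filter_upwards [hscale.eventually hd] with t ht
    rwa [smul_smul]

theorem exists_pos_add_smul_mem (hF : Convex ℝ F) (hx : x ∈ F) (hd : d ∈ faceDirection hF hx) :
    ∃ t : ℝ, 0 < t ∧ x + t • d ∈ F :=
  have h : ∀ᶠ t in 𝓝[>] (0 : ℝ), x + t • d ∈ F :=
    Filter.Eventually.filter_mono nhdsWithin_le_nhds hd
  ((eventually_mem_nhdsWithin (a := (0 : ℝ)) (s := Set.Ioi 0)).and h).exists

theorem mem_faceDirection_of_add_sub_mem (hF : Convex ℝ F) (hx : x ∈ F) {a b : ℝ} (ha : 0 < a)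
    (hb : 0 < b) (hadd : x + a • d ∈ F) (hsub : x - b • d ∈ F) : d ∈ faceDirection hF hx := by
  have hconv : Convex ℝ {t : ℝ | x + t • d ∈ F} := by
    intro s hs t ht p q hp hq hpq
    rw [Set.mem_ofPred_eq]
    convert hF hs ht hp hq hpq using 1
    obtain rfl : p = 1 - q := by linarith
    module
  filter_upwards [Icc_mem_nhds (neg_lt_zero.2 hb) ha] with t ht
  exact hconv.ordConnected.out (by simpa [sub_eq_add_neg] using hsub) hadd ht

theorem faceDirection_le_of_sub_mem (hF : Convex ℝ F) (hx : x ∈ F) (hz : z ∈ F)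
    (hzx : z - x ∈ faceDirection hF hx) : faceDirection hF hz ≤ faceDirection hF hx := by
  intro d hd
  obtain ⟨η, hη, hηF⟩ := exists_pos_add_smul_mem hF hx (neg_mem hzx)
  have hscale : Filter.Tendsto (fun t : ℝ => (1 + η) / η * t) (𝓝 0) (𝓝 0) :=
    Continuous.tendsto' (by fun_prop) _ _ (by simp)
  filter_upwards [hscale.eventually hd] with t ht
  convert hF hηF ht (a := 1 / (1 + η)) (b := η / (1 + η)) (by positivity) (by positivity)
    (by field_simp) using 1
  match_scalars <;> field_simp
  ring

theorem mem_extremePoints_iff_faceDirection_eq_bot (hF : Convex ℝ F) (hx : x ∈ F) :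
    x ∈ F.extremePoints ℝ ↔ faceDirection hF hx = ⊥ := by
  refine ⟨fun hext => (Submodule.eq_bot_iff _).2 fun d hd => ?_, fun h => ⟨hx, ?_⟩⟩
  · obtain ⟨s, hs, hsF⟩ := exists_pos_add_smul_mem hF hx hd
    obtain ⟨t, ht, htF⟩ := exists_pos_add_smul_mem hF hx (neg_mem hd)
    have hseg : x ∈ openSegment ℝ (x + s • d) (x + t • -d) := by
      refine ⟨t / (s + t), s / (s + t), by positivity, by positivity, by field_simp; ring, ?_⟩
      match_scalars <;> field_simp <;> ring
    simpa [hs.ne'] using hext.2 hsF htF hseg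
  · rintro a ha b hb ⟨s, t, hs, ht, hst, rfl⟩
    have hab : a - b ∈ faceDirection hF hx := by
      refine mem_faceDirection_of_add_sub_mem hF hx ht hs ?_ ?_
      · convert ha using 1
        obtain rfl : s = 1 - t := by linarith
        module
      · convert hb using 1
        obtain rfl : s = 1 - t := by linarith
        module
    obtain rfl : a = b := sub_eq_zero.1 (by simpa [h] using hab)
    exact (Convex.combo_self hst a).symm

/-- Compactness of every intersection with a line, each line carrying the topology of `ℝ`. -/
def IsLineCompact (F : Set V) : Prop :=
  ∀ x d : V, d ≠ 0 → IsCompact {t : ℝ | x + t • d ∈ F}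

theorem isLineCompact_of_isClosed_of_isBounded {V : Type*} [NormedAddCommGroup V]
    [NormedSpace ℝ V] {F : Set V} (hcl : IsClosed F) (hb : Bornology.IsBounded F) :
    IsLineCompact F := by
  intro x d hd
  have hanti : AntilipschitzWith ‖d‖₊⁻¹ fun t : ℝ => x + t • d := by
    refine AntilipschitzWith.of_le_mul_dist fun s t => ?_
    rw [dist_add_left, dist_eq_norm, dist_eq_norm, ← sub_smul, norm_smul, NNReal.coe_inv,
      coe_nnnorm, mul_comm, mul_inv_cancel_right₀ (norm_ne_zero_iff.2 hd)]
  exact Metric.isCompact_of_isClosed_isBounded (hcl.preimage (by fun_prop))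
    (hanti.isBounded_preimage hb)

theorem IsLineCompact.exists_add_smul_faceDirection_lt (hF : Convex ℝ F) (hc : IsLineCompact F)
    (hx : x ∈ F) (hd : d ∈ faceDirection hF hx) (hd0 : d ≠ 0) :
    ∃ (t : ℝ) (ht : x + t • d ∈ F), 0 < t ∧ faceDirection hF ht < faceDirection hF hx := by
  obtain ⟨t, ht, hmax⟩ := (hc x d hd0).exists_isGreatest ⟨0, by simpa using hx⟩
  obtain ⟨η, hη, hηF⟩ := exists_pos_add_smul_mem hF hx hd
  refine ⟨t, ht, hη.trans_le (hmax hηF), lt_of_le_of_ne ?_ fun heq => ?_⟩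
  · exact faceDirection_le_of_sub_mem hF hx ht (by simpa using Submodule.smul_mem _ t hd)
  · obtain ⟨s, hs, hsF⟩ := exists_pos_add_smul_mem hF ht (heq ▸ hd)
    have : t + s ≤ t := hmax (by simpa [add_smul, add_assoc] using hsF)
    linarith

theorem IsLineCompact.mem_convexHull_extremePoints (hF : Convex ℝ F) (hc : IsLineCompact F)
    (hx : x ∈ F) [FiniteDimensional ℝ (faceDirection hF hx)] :
    x ∈ convexHull ℝ (F.extremePoints ℝ ∩ {e | e - x ∈ faceDirection hF hx}) := by
  induction hn : Module.finrank ℝ (faceDirection hF hx) using Nat.strong_induction_on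
    generalizing x with
  | _ n ih =>
    have endpoint_mem {d : V} (hd : d ∈ faceDirection hF hx) (hd0 : d ≠ 0) : ∃ t : ℝ, 0 < t ∧
        x + t • d ∈ convexHull ℝ (F.extremePoints ℝ ∩ {e | e - x ∈ faceDirection hF hx}) := by
      obtain ⟨t, htF, ht, hlt⟩ := hc.exists_add_smul_faceDirection_lt hF hx hd hd0
      have := Submodule.finiteDimensional_of_le hlt.le
      refine ⟨t, ht, convexHull_mono (Set.inter_subset_inter_right _ fun e he => ?_)
        (ih _ (hn ▸ Submodule.finrank_lt_finrank_of_lt hlt) htF rfl)⟩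
      have := add_mem (hlt.le he) (Submodule.smul_mem _ t hd)
      rwa [sub_add_eq_sub_sub, sub_add_cancel] at this
    obtain hbot | hbot := eq_or_ne (faceDirection hF hx) ⊥
    · exact subset_convexHull ℝ _
        ⟨(mem_extremePoints_iff_faceDirection_eq_bot hF hx).2 hbot, by simp⟩
    · obtain ⟨d, hd, hd0⟩ := Submodule.exists_mem_ne_zero_of_ne_bot hbot
      obtain ⟨s, hs, hsmem⟩ := endpoint_mem hd hd0
      obtain ⟨t, ht, htmem⟩ := endpoint_mem (neg_mem hd) (neg_ne_zero.2 hd0)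
      convert convex_convexHull ℝ _ hsmem htmem (a := t / (s + t)) (b := s / (s + t))
        (by positivity) (by positivity) (by field_simp; ring) using 1
      match_scalars <;> field_simp <;> ring

theorem IsLineCompact.exists_finset_extremePoints (hF : Convex ℝ F) (hc : IsLineCompact F)
    (hx : x ∈ F) [FiniteDimensional ℝ (faceDirection hF hx)] :
    ∃ T : Finset V, (T : Set V) ⊆ F.extremePoints ℝ ∧
      T.card ≤ Module.finrank ℝ (faceDirection hF hx) + 1 ∧ x ∈ convexHull ℝ (T : Set V) := by
  have hmem := hc.mem_convexHull_extremePoints hF hx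
  rw [convexHull_eq_union] at hmem
  simp only [Set.mem_iUnion, exists_prop] at hmem
  obtain ⟨T, hT, hind, hxT⟩ := hmem
  have hspan : vectorSpan ℝ (Set.range ((↑) : T → V)) ≤ faceDirection hF hx := by
    rw [Subtype.range_coe, vectorSpan, Submodule.span_le]
    rintro _ ⟨a, ha, b, hb, rfl⟩
    simpa using sub_mem (show a - x ∈ faceDirection hF hx from (hT ha).2) (hT hb).2
  refine ⟨T, fun e he => (hT he).1, ?_, hxT⟩
  calc T.card = Fintype.card T := (Fintype.card_coe T).symm
    _ ≤ Module.finrank ℝ (vectorSpan ℝ (Set.range ((↑) : T → V))) + 1 := hind.card_le_finrank_succ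
    _ ≤ _ := Nat.add_le_add_right (Submodule.finrank_mono hspan) 1

end Faces

/-! ### The duality mapping -/

section Duality

variable {U : Type*} [NormedAddCommGroup U] [NormedSpace ℝ U] {u : U} {s : StrongDual ℝ U}

theorem apply_le_norm_mul_norm (s : StrongDual ℝ U) (u : U) : s u ≤ ‖s‖ * ‖u‖ :=
  (le_abs_self _).trans (s.le_opNorm u)

theorem apply_self_of_mem_dualityMap (hs : s ∈ dualityMap u) : s u = ‖u‖ * ‖u‖ := by
  rw [hs.2, hs.1]

theorem mem_dualityMap_iff : s ∈ dualityMap u ↔ ‖s‖ ≤ ‖u‖ ∧ ‖u‖ * ‖u‖ ≤ s u := by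
  refine ⟨fun h => ⟨h.1.le, (apply_self_of_mem_dualityMap h).ge⟩, fun ⟨hsu, hus⟩ => ?_⟩
  have hnorm : ‖s‖ = ‖u‖ := by
    obtain h | h := (norm_nonneg u).eq_or_lt
    · exact le_antisymm hsu (h ▸ norm_nonneg s)
    · exact le_antisymm hsu (le_of_mul_le_mul_right (hus.trans (apply_le_norm_mul_norm s u)) h)
  refine ⟨hnorm, le_antisymm ?_ (hnorm ▸ hus)⟩
  simpa only [mul_comm] using apply_le_norm_mul_norm s u

theorem dualityMap_nonempty (u : U) : (dualityMap u).Nonempty := by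
  obtain ⟨g, hg, hgu⟩ := exists_dual_vector'' ℝ u
  refine ⟨‖u‖ • g, mem_dualityMap_iff.2 ⟨?_, ?_⟩⟩
  · rw [norm_smul, norm_norm]
    exact mul_le_of_le_one_right (norm_nonneg u) hg
  · simp [hgu]

theorem isExposed_dualityMap (u : U) : IsExposed ℝ (Metric.closedBall 0 ‖u‖) (dualityMap u) := by
  refine fun _ => ⟨ContinuousLinearMap.apply ℝ ℝ u, Set.ext fun s => ?_⟩
  obtain ⟨t, ht⟩ := dualityMap_nonempty u
  simp only [mem_dualityMap_iff, Set.mem_ofPred_eq, mem_closedBall_zero_iff,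
    ContinuousLinearMap.apply_apply]
  refine and_congr_right fun _ => ⟨fun hs r hr => ?_, fun hs => ?_⟩
  · calc r u ≤ ‖r‖ * ‖u‖ := apply_le_norm_mul_norm r u
      _ ≤ ‖u‖ * ‖u‖ := by gcongr
      _ ≤ s u := hs
  · exact (apply_self_of_mem_dualityMap ht).ge.trans (hs t ht.1.le)

theorem dualityMap_convex (u : U) : Convex ℝ (dualityMap u) :=
  (isExposed_dualityMap u).convex (convex_closedBall _ _)

theorem dualityMap_isLineCompact (u : U) : IsLineCompact (dualityMap u) :=
  isLineCompact_of_isClosed_of_isBounded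
    ((isExposed_dualityMap u).isClosed Metric.isClosed_closedBall)
    (Metric.isBounded_closedBall.subset (isExposed_dualityMap u).subset)

theorem dualityMap_subsingleton [StrictConvexSpace ℝ (StrongDual ℝ U)] (u : U) :
    (dualityMap u).Subsingleton := by
  intro s hs t ht
  by_contra hne
  have hlt : ‖(1 / 2 : ℝ) • s + (1 / 2 : ℝ) • t‖ < ‖u‖ :=
    norm_combo_lt_of_ne hs.1.le ht.1.le hne (by norm_num) (by norm_num) (by norm_num)
  exact hlt.ne (dualityMap_convex u hs ht (by norm_num) (by norm_num) (by norm_num)).1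

theorem exists_isDualityOperator [StrictConvexSpace ℝ (StrongDual ℝ U)] :
    ∃ J : U → StrongDual ℝ U, IsDualityOperator J := by
  choose J hJ using dualityMap_nonempty (U := U)
  exact ⟨J, fun u => (dualityMap_subsingleton u).eq_singleton_of_mem (hJ u)⟩

theorem exists_norm_le_one_apply_eq_norm [FiniteDimensional ℝ U] (s : StrongDual ℝ U) :
    ∃ x : U, ‖x‖ ≤ 1 ∧ s x = ‖s‖ := by
  have : ProperSpace U := FiniteDimensional.proper ℝ U
  obtain ⟨x, hx, hsx⟩ := (isCompact_closedBall (0 : U) 1).exists_sSup_image_eq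
    ⟨0, by simp⟩ (f := fun x => ‖s x‖) (by fun_prop)
  rw [s.sSup_unitClosedBall_eq_norm] at hsx
  rw [mem_closedBall_zero_iff] at hx
  obtain h | h := le_total 0 (s x)
  · exact ⟨x, hx, by rw [hsx, Real.norm_of_nonneg h]⟩
  · exact ⟨-x, by rwa [norm_neg], by rw [map_neg, hsx, Real.norm_of_nonpos h]⟩

theorem mem_dualityMap_norm_smul {x : U} (hx : ‖x‖ ≤ 1) (hsx : s x = ‖s‖) :
    s ∈ dualityMap (‖s‖ • x) := by
  have hle : ‖s‖ ≤ ‖s‖ * ‖x‖ := hsx ▸ apply_le_norm_mul_norm s x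
  have hge : ‖s‖ * ‖x‖ ≤ ‖s‖ := mul_le_of_le_one_right (norm_nonneg s) hx
  have hnorm : ‖‖s‖ • x‖ = ‖s‖ := by rw [norm_smul, norm_norm, hge.antisymm hle]
  exact ⟨hnorm.symm, by rw [hnorm, map_smul, hsx, smul_eq_mul]⟩

theorem exists_mem_dualityMap_of_forall_norm_le (W : Submodule ℝ U) [FiniteDimensional ℝ W]
    (hs : ∀ t : StrongDual ℝ U, (∀ w ∈ W, t w = s w) → ‖s‖ ≤ ‖t‖) :
    ∃ w ∈ W, s ∈ dualityMap w := by
  obtain ⟨g, hg, hgnorm⟩ := exists_extension_norm_eq W (s.comp W.subtypeL)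
  obtain ⟨w, hw, hsw⟩ := exists_norm_le_one_apply_eq_norm (s.comp W.subtypeL)
  have hrestrict : ‖s.comp W.subtypeL‖ = ‖s‖ := by
    refine le_antisymm ?_ (hgnorm ▸ hs g fun w hw => hg ⟨w, hw⟩)
    exact (s.opNorm_comp_le _).trans (mul_le_of_le_one_right (norm_nonneg s) W.norm_subtypeL_le)
  exact ⟨‖s‖ • w, W.smul_mem _ w.2, mem_dualityMap_norm_smul hw (hsw.trans hrestrict)⟩

theorem exists_mem_dualityMap_sum_smul {ι : Type*} [Fintype ι] (ν : ι → U)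
    (hs : ∀ t : StrongDual ℝ U, (∀ i, t (ν i) = s (ν i)) → ‖s‖ ≤ ‖t‖) :
    ∃ a : ι → ℝ, s ∈ dualityMap (∑ i, a i • ν i) := by
  have := FiniteDimensional.span_of_finite ℝ (Set.finite_range ν)
  obtain ⟨w, hw, hsw⟩ := exists_mem_dualityMap_of_forall_norm_le (Submodule.span ℝ (Set.range ν))
    fun t ht => hs t fun i => ht _ (Submodule.subset_span ⟨i, rfl⟩)
  obtain ⟨a, rfl⟩ := (Submodule.mem_span_range_iff_exists_fun ℝ).1 hw
  exact ⟨a, hsw⟩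

end Duality

/-! ### Riesz maps -/

section Riesz

theorem innerProductSpaceable_of_linearIsometry {E F : Type*} [NormedAddCommGroup E]
    [NormedSpace ℝ E] [NormedAddCommGroup F] [NormedSpace ℝ F] [InnerProductSpaceable F]
    (L : E →ₗᵢ[ℝ] F) : InnerProductSpaceable E :=
  ⟨fun x y => by
    simpa only [← map_add, ← map_sub, L.norm_map] using
      InnerProductSpaceable.parallelogram_identity (L x) (L y)⟩

theorem exists_isRieszMap_of_innerProductSpace {H : Type*} [NormedAddCommGroup H]
    [InnerProductSpace ℝ H] [CompleteSpace H] :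
    ∃ R : H ≃ₗᵢ[ℝ] StrongDual ℝ H, IsRieszMap R := by
  refine ⟨{ InnerProductSpace.toDual ℝ H with map_smul' := by simp }, fun x y => ?_⟩
  simpa only [sq] using! re_inner_eq_norm_add_mul_self_sub_norm_sub_mul_self_div_four (𝕜 := ℝ) x y

theorem exists_isRieszMap_of_innerProductSpaceable {H : Type*} [NormedAddCommGroup H]
    [NormedSpace ℝ H] [CompleteSpace H] [InnerProductSpaceable H] :
    ∃ R : H ≃ₗᵢ[ℝ] StrongDual ℝ H, IsRieszMap R :=
  letI := InnerProductSpace.ofNorm ℝ (E := H) InnerProductSpaceable.parallelogram_identity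
  exists_isRieszMap_of_innerProductSpace

variable {U : Type*} [NormedAddCommGroup U] [NormedSpace ℝ U]

theorem innerProductSpaceable_of_dual [InnerProductSpaceable (StrongDual ℝ U)] :
    InnerProductSpaceable U := by
  obtain ⟨R, -⟩ := exists_isRieszMap_of_innerProductSpaceable (H := StrongDual ℝ U)
  exact innerProductSpaceable_of_linearIsometry
    (R.symm.toLinearIsometry.comp (NormedSpace.inclusionInDoubleDualLi ℝ))

theorem exists_isRieszMap_of_dual [CompleteSpace U] [InnerProductSpaceable (StrongDual ℝ U)] :
    ∃ R : U ≃ₗᵢ[ℝ] StrongDual ℝ U, IsRieszMap R :=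
  have := innerProductSpaceable_of_dual (U := U)
  exists_isRieszMap_of_innerProductSpaceable

theorem IsRieszMap.mem_dualityMap {R : U ≃ₗᵢ[ℝ] StrongDual ℝ U} (hR : IsRieszMap R) (u : U) :
    R u ∈ dualityMap u := by
  refine ⟨R.norm_map u, ?_⟩
  rw [hR, sub_self, norm_zero, ← two_smul ℝ u, norm_smul, R.norm_map, Real.norm_two]
  ring

end Riesz

/-! ### Extreme points of the values of the duality mapping -/

section DualityFace

variable {U : Type*} [NormedAddCommGroup U] [NormedSpace ℝ U] {u : U} {s : StrongDual ℝ U}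

theorem exists_smul_eq_of_mem_extremePoints_closedBall {E : Type*} [NormedAddCommGroup E]
    [NormedSpace ℝ E] {r : ℝ} (hr : 0 < r) {x : E}
    (hx : x ∈ (Metric.closedBall (0 : E) r).extremePoints ℝ) :
    ∃ e ∈ (Metric.closedBall (0 : E) 1).extremePoints ℝ, r • e = x := by
  have himage := image_extremePoints (LinearEquiv.smulOfNeZero ℝ E r hr.ne')
    (Metric.closedBall (0 : E) 1)
  have hball : LinearEquiv.smulOfNeZero ℝ E r hr.ne' '' Metric.closedBall (0 : E) 1 =
      Metric.closedBall 0 r := smul_unitClosedBall_of_nonneg hr.le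
  rw [hball] at himage
  exact himage.ge hx

theorem apply_eq_zero_of_mem_faceDirection (hs : s ∈ dualityMap u) {d : StrongDual ℝ U}
    (hd : d ∈ faceDirection (dualityMap_convex u) hs) : d u = 0 := by
  obtain ⟨t, ht, hmem⟩ := exists_pos_add_smul_mem (dualityMap_convex u) hs hd
  have happly : (s + t • d) u = s u :=
    (apply_self_of_mem_dualityMap hmem).trans (apply_self_of_mem_dualityMap hs).symm
  simpa [ht.ne'] using happly

theorem finrank_lt_card_of_forall_dotProduct_eq_zero {W ι : Type*} [AddCommGroup W] [Module ℝ W]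
    [Fintype ι] {V : Submodule ℝ W} {Φ : W →ₗ[ℝ] ι → ℝ} (hΦ : Disjoint V Φ.ker) {a : ι → ℝ}
    (ha : a ≠ 0) (h : ∀ d ∈ V, a ⬝ᵥ Φ d = 0) :
    FiniteDimensional ℝ V ∧ Module.finrank ℝ V < Fintype.card ι := by
  have hinj : Function.Injective (Φ.domRestrict V) :=
    LinearMap.injective_domRestrict_iff.2 hΦ
  refine ⟨FiniteDimensional.of_injective _ hinj, ?_⟩
  rw [← LinearMap.finrank_range_of_inj hinj, ← Module.finrank_fintype_fun_eq_card ℝ]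
  refine Submodule.finrank_lt fun htop => ha ?_
  obtain ⟨d, rfl⟩ := LinearMap.range_eq_top.1 htop a
  exact dotProduct_self_eq_zero.1 (h d d.2)

theorem exists_finset_extremePoints_dualityMap {ι : Type*} [Fintype ι] {ν : ι → U} {a : ι → ℝ}
    (hne : ∑ i, a i • ν i ≠ 0) (hs : s ∈ dualityMap (∑ i, a i • ν i))
    (hd : ∀ d ∈ faceDirection (dualityMap_convex _) hs, (∀ i, d (ν i) = 0) → d = 0) :
    ∃ T : Finset (StrongDual ℝ U),
      (T : Set (StrongDual ℝ U)) ⊆ (dualityMap (∑ i, a i • ν i)).extremePoints ℝ ∧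
      T.card ≤ Fintype.card ι ∧ s ∈ convexHull ℝ (T : Set (StrongDual ℝ U)) := by
  let Φ : StrongDual ℝ U →ₗ[ℝ] ι → ℝ :=
    LinearMap.pi fun i => (ContinuousLinearMap.apply ℝ ℝ (ν i)).toLinearMap
  obtain ⟨_, hdim⟩ : FiniteDimensional ℝ (faceDirection (dualityMap_convex _) hs) ∧
      Module.finrank ℝ (faceDirection (dualityMap_convex _) hs) < Fintype.card ι := by
    refine finrank_lt_card_of_forall_dotProduct_eq_zero (Φ := Φ) (a := a) ?_ ?_ fun d hd => ?_
    · exact Submodule.disjoint_def.2 fun d hdV hdΦ => hd d hdV (congrFun hdΦ)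
    · rintro rfl
      simp at hne
    · simpa [Φ, dotProduct, map_sum] using apply_eq_zero_of_mem_faceDirection hs hd
  obtain ⟨T, hT, hcard, hsT⟩ :=
    (dualityMap_isLineCompact _).exists_finset_extremePoints (dualityMap_convex _) hs
  exact ⟨T, hT, hcard.trans hdim, hsT⟩

theorem exists_sum_smul_extremePoints_closedBall {ι : Type*} [Fintype ι] {ν : ι → U} {a : ι → ℝ}
    (hs : s ∈ dualityMap (∑ i, a i • ν i))
    (hd : ∀ d ∈ faceDirection (dualityMap_convex _) hs, (∀ i, d (ν i) = 0) → d = 0) :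
    ∃ K ≤ Fintype.card ι, ∃ (c : Fin K → ℝ) (e : Fin K → StrongDual ℝ U),
      (∀ k, e k ∈ (Metric.closedBall (0 : StrongDual ℝ U) 1).extremePoints ℝ) ∧
      s = ∑ k, c k • e k := by
  obtain hu | hu := eq_or_ne (∑ i, a i • ν i) 0
  · have hs0 : s = 0 := norm_eq_zero.1 (by rw [hs.1, hu, norm_zero])
    exact ⟨0, zero_le, Fin.elim0, Fin.elim0, fun k => k.elim0, by simpa using hs0⟩
  · obtain ⟨T, hT, hcard, hsT⟩ := exists_finset_extremePoints_dualityMap hu hs hd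
    obtain ⟨c, -, -, hc⟩ := Finset.mem_convexHull'.1 hsT
    choose e he hsmul using fun t : T => exists_smul_eq_of_mem_extremePoints_closedBall
      (norm_pos_iff.2 hu) ((isExposed_dualityMap _).isExtreme.extremePoints_subset_extremePoints
        (hT t.2))
    refine ⟨T.card, hcard, fun k => c (T.equivFin.symm k) * ‖∑ i, a i • ν i‖,
      fun k => e (T.equivFin.symm k), fun k => he _, ?_⟩
    rw [← hc, ← Finset.sum_coe_sort, ← T.equivFin.symm.sum_comp]
    simp only [mul_smul, hsmul]

end DualityFace

/-! ### Splitting of the dual -/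

namespace SplitPair

variable {X U : Type*} [NormedAddCommGroup X] [NormedSpace ℝ X] [NormedAddCommGroup U]
  [NormedSpace ℝ U] {N₀ : ℕ} (D : SplitPair X U N₀)

/-- The projector `X' → U'` as a continuous linear map. -/
noncomputable def dualProjL : StrongDual ℝ X →L[ℝ] StrongDual ℝ U :=
  (ContinuousLinearMap.compL ℝ U X ℝ).flip D.incl

theorem coe_dualProjL : ⇑D.dualProjL = D.dualProj := rfl

theorem dualProj_add (f g : StrongDual ℝ X) :
    D.dualProj (f + g) = D.dualProj f + D.dualProj g :=
  map_add D.dualProjL f g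

theorem dualProj_apply (f : StrongDual ℝ X) (u : U) : D.dualProj f u = f (D.incl u) := rfl

theorem dualProj_sum_smul_p (b : Fin N₀ → ℝ) : D.dualProj (∑ n, b n • D.p n) = 0 := by
  ext u
  simp [dualProj_apply, D.p_incl]

theorem sum_smul_p_pstar (b : Fin N₀ → ℝ) (m : Fin N₀) :
    (∑ n, b n • D.p n) (D.pstar m) = b m := by
  simp [D.biorthonormal]

theorem mem_nullSpace_iff {q : StrongDual ℝ X} :
    q ∈ D.nullSpace ↔ ∃ b : Fin N₀ → ℝ, ∑ n, b n • D.p n = q :=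
  Submodule.mem_span_range_iff_exists_fun ℝ

theorem exists_incl_add_sum (x : X) :
    ∃ (u : U) (c : Fin N₀ → ℝ), D.incl u + ∑ n, c n • D.pstar n = x := by
  have hx : x ∈ D.incl.range ⊔ Submodule.span ℝ (Set.range D.pstar) :=
    D.isCompl.sup_eq_top ▸ Submodule.mem_top
  obtain ⟨_, ⟨u, rfl⟩, q, hq, rfl⟩ := Submodule.mem_sup.1 hx
  obtain ⟨c, rfl⟩ := (Submodule.mem_span_range_iff_exists_fun ℝ).1 hq
  exact ⟨u, c, rfl⟩

theorem exists_incl_eq {x : X} (hx : ∀ n, D.p n x = 0) : ∃ u, D.incl u = x := by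
  obtain ⟨u, c, rfl⟩ := D.exists_incl_add_sum x
  have hc : c = 0 := by
    ext n
    simpa [D.p_incl, D.biorthonormal] using hx n
  exact ⟨u, by simp [hc]⟩

theorem dual_ext {f g : StrongDual ℝ X} (hproj : D.dualProj f = D.dualProj g)
    (hpstar : ∀ n, f (D.pstar n) = g (D.pstar n)) : f = g := by
  ext x
  obtain ⟨u, c, rfl⟩ := D.exists_incl_add_sum x
  have hincl : f (D.incl u) = g (D.incl u) := DFunLike.congr_fun hproj u
  simp [hincl, hpstar]

variable [CompleteSpace X] [CompleteSpace U]

/-- The inclusion `U' ⊆ X'` as a continuous linear map. -/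
noncomputable def dualInclL : StrongDual ℝ U →L[ℝ] StrongDual ℝ X :=
  (ContinuousLinearMap.compL ℝ X U ℝ).flip D.proj

theorem coe_dualInclL : ⇑D.dualInclL = D.dualIncl := rfl

theorem dualIncl_sum_smul {ι : Type*} [Fintype ι] (c : ι → ℝ) (s : ι → StrongDual ℝ U) :
    D.dualIncl (∑ i, c i • s i) = ∑ i, c i • D.dualIncl (s i) := by
  simp only [← coe_dualInclL, map_sum, map_smul]

theorem proj_incl_add {q : X} (u : U) (hq : q ∈ Submodule.span ℝ (Set.range D.pstar)) :
    D.proj (D.incl u + q) = u := by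
  unfold proj
  have : FiniteDimensional ℝ (Submodule.span ℝ (Set.range D.pstar)) :=
    FiniteDimensional.span_of_finite ℝ (Set.finite_range D.pstar)
  have : CompleteSpace (Submodule.span ℝ (Set.range D.pstar)) := FiniteDimensional.complete ℝ _
  have hsplit : D.incl u + q = D.incl.coprodSubtypeLEquivOfIsCompl D.isCompl
      (LinearMap.ker_eq_bot.2 D.incl_injective) (u, ⟨q, hq⟩) := rfl
  rw [hsplit]
  simp

theorem dualIncl_incl (s : StrongDual ℝ U) (u : U) : D.dualIncl s (D.incl u) = s u :=
  congrArg s (by simpa using D.proj_incl_add u (Submodule.zero_mem _))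

theorem dualIncl_pstar (s : StrongDual ℝ U) (n : Fin N₀) : D.dualIncl s (D.pstar n) = 0 := by
  have hproj : D.proj (D.pstar n) = 0 := by
    simpa using D.proj_incl_add 0 (Submodule.subset_span (Set.mem_range_self n))
  exact (congrArg s hproj).trans (map_zero s)

theorem dualProj_dualIncl (s : StrongDual ℝ U) : D.dualProj (D.dualIncl s) = s :=
  ContinuousLinearMap.ext (D.dualIncl_incl s)

theorem dualProj_dualIncl_add_sum (s : StrongDual ℝ U) (b : Fin N₀ → ℝ) :
    D.dualProj (D.dualIncl s + ∑ n, b n • D.p n) = s := by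
  rw [dualProj_add, dualProj_dualIncl, dualProj_sum_smul_p, add_zero]

theorem dualIncl_add_sum_pstar (s : StrongDual ℝ U) (b : Fin N₀ → ℝ) (m : Fin N₀) :
    (D.dualIncl s + ∑ n, b n • D.p n) (D.pstar m) = b m := by
  rw [_root_.add_apply, dualIncl_pstar, sum_smul_p_pstar, zero_add]

theorem eq_dualIncl_add_sum (f : StrongDual ℝ X) :
    f = D.dualIncl (D.dualProj f) + ∑ n, f (D.pstar n) • D.p n :=
  D.dual_ext (D.dualProj_dualIncl_add_sum _ _).symm fun n =>
    (D.dualIncl_add_sum_pstar (D.dualProj f) (fun m => f (D.pstar m)) n).symm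

theorem eq_of_eq_dualIncl_add_sum {f : StrongDual ℝ X} {s : StrongDual ℝ U} {b : Fin N₀ → ℝ}
    (h : f = D.dualIncl s + ∑ n, b n • D.p n) :
    s = D.dualProj f ∧ b = fun n => f (D.pstar n) := by
  subst h
  exact ⟨(D.dualProj_dualIncl_add_sum s b).symm, funext fun n =>
    (D.dualIncl_add_sum_pstar s b n).symm⟩

theorem exists_unique_decomposition (f : StrongDual ℝ X) :
    ∃ p₀ ∈ D.nullSpace, f = p₀ + D.dualIncl (D.dualProj f) ∧
      ∀ p₁ ∈ D.nullSpace, ∀ s₁ : StrongDual ℝ U,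
        f = p₁ + D.dualIncl s₁ → p₁ = p₀ ∧ s₁ = D.dualProj f := by
  refine ⟨_, D.mem_nullSpace_iff.2 ⟨_, rfl⟩, (D.eq_dualIncl_add_sum f).trans (add_comm _ _),
    fun p₁ hp₁ s₁ h => ?_⟩
  obtain ⟨b, rfl⟩ := D.mem_nullSpace_iff.1 hp₁
  obtain ⟨hs, rfl⟩ := D.eq_of_eq_dualIncl_add_sum (h.trans (add_comm _ _))
  exact ⟨rfl, hs⟩

end SplitPair

/-! ### Measurements -/

section Measure

variable {X U : Type*} [NormedAddCommGroup X] [NormedSpace ℝ X] [NormedAddCommGroup U]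
  [NormedSpace ℝ U] {N₀ M : ℕ} {D : SplitPair X U N₀} {ν : Fin M → X}

/-- The measurement operator `f ↦ (⟨ν_1, f⟩, …, ⟨ν_M, f⟩)` as a continuous linear map. -/
noncomputable def measureL (ν : Fin M → X) : StrongDual ℝ X →L[ℝ] Fin M → ℝ :=
  ContinuousLinearMap.pi fun m => ContinuousLinearMap.apply ℝ ℝ (ν m)

theorem coe_measureL (ν : Fin M → X) : ⇑(measureL ν) = measure ν := rfl

theorem measure_add (f g : StrongDual ℝ X) : measure ν (f + g) = measure ν f + measure ν g :=
  map_add (measureL ν) f g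

theorem measure_sum_smul_p (b : Fin N₀ → ℝ) :
    measure ν (∑ n, b n • D.p n) = ∑ n, b n • crossVec D ν n := by
  simp only [← coe_measureL, map_sum, map_smul, crossVec]

theorem dotProduct_measure (w : Fin M → ℝ) (f : StrongDual ℝ X) :
    w ⬝ᵥ measure ν f = f (∑ j, w j • ν j) := by
  simp [dotProduct, measure]

theorem measure_surjective (hν : LinearIndependent ℝ ν) : Function.Surjective (measure ν) := by
  intro z
  obtain ⟨f, hf⟩ := SeparatingDual.dualMap_surjective_iff.2
    hν.fintypeLinearCombination_injective (dotProductEquiv ℝ (Fin M) z)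
  refine ⟨f, dotProduct_eq _ _ fun w => ?_⟩
  rw [dotProduct_comm, dotProduct_measure]
  exact DFunLike.congr_fun hf w

variable [CompleteSpace X] [CompleteSpace U]

theorem measure_dualIncl_dualProj_add_sum (f : StrongDual ℝ X) :
    measure ν (D.dualIncl (D.dualProj f)) + ∑ n, f (D.pstar n) • crossVec D ν n =
      measure ν f := by
  rw [← measure_sum_smul_p, ← measure_add, ← D.eq_dualIncl_add_sum]

theorem eq_of_dualProj_eq_of_measure_eq (hv : LinearIndependent ℝ (crossVec D ν))
    {f g : StrongDual ℝ X} (hproj : D.dualProj f = D.dualProj g)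
    (hmeasure : measure ν f = measure ν g) : f = g := by
  rw [← measure_dualIncl_dualProj_add_sum f (D := D),
    ← measure_dualIncl_dualProj_add_sum g (D := D), hproj, add_right_inj] at hmeasure
  exact D.dual_ext hproj (congrFun (hv.fintypeLinearCombination_injective hmeasure))

theorem exists_dualProj_eq_measure_eq {s : StrongDual ℝ U} {z : Fin M → ℝ}
    (hz : z - measure ν (D.dualIncl s) ∈ Submodule.span ℝ (Set.range (crossVec D ν))) :
    ∃ f, D.dualProj f = s ∧ measure ν f = z := by
  obtain ⟨b, hb⟩ := (Submodule.mem_span_range_iff_exists_fun ℝ).1 hz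
  refine ⟨D.dualIncl s + ∑ n, b n • D.p n, D.dualProj_dualIncl_add_sum s b, ?_⟩
  rw [measure_add, measure_sum_smul_p, hb, add_sub_cancel]

open scoped Pointwise in
theorem isBounded_setOf_dualProj_mem_measure_mem (hv : LinearIndependent ℝ (crossVec D ν))
    {A : Set (StrongDual ℝ U)} (hA : Bornology.IsBounded A) {C : Set (Fin M → ℝ)}
    (hC : Bornology.IsBounded C) :
    Bornology.IsBounded {f | D.dualProj f ∈ A ∧ measure ν f ∈ C} := by
  let P : (Fin N₀ → ℝ) →L[ℝ] StrongDual ℝ X :=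
    LinearMap.toContinuousLinearMap (Fintype.linearCombination ℝ D.p)
  let V : (Fin N₀ → ℝ) →ₗ[ℝ] Fin M → ℝ := Fintype.linearCombination ℝ (crossVec D ν)
  obtain ⟨κ, -, hκ⟩ := V.exists_antilipschitzWith
    (LinearMap.ker_eq_bot.2 hv.fintypeLinearCombination_injective)
  have hI : Bornology.IsBounded (D.dualIncl '' A) := D.dualInclL.lipschitz.isBounded_image hA
  have hP : Bornology.IsBounded (P '' (V ⁻¹' (C - measure ν '' (D.dualIncl '' A)))) :=
    P.lipschitz.isBounded_image
      (hκ.isBounded_preimage (hC.sub ((measureL ν).lipschitz.isBounded_image hI)))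
  refine (hI.add hP).subset fun f ⟨hfA, hfC⟩ => ?_
  have hIf := Set.mem_image_of_mem D.dualIncl hfA
  refine Set.mem_add.2 ⟨_, hIf, _, ⟨fun n => f (D.pstar n), ?_, rfl⟩,
    (D.eq_dualIncl_add_sum f).symm⟩
  exact Set.mem_sub.2 ⟨_, hfC, _, Set.mem_image_of_mem _ hIf,
    sub_eq_of_eq_add' (measure_dualIncl_dualProj_add_sum f).symm⟩

end Measure

/-! ### Biorthogonal systems -/

section Biorthogonal

variable {M N₀ K : ℕ} {v : Fin N₀ → Fin M → ℝ} {u w w' : Fin K → Fin M → ℝ}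

theorem IsBiorthogonal.eq (h : IsBiorthogonal v u w) (h' : IsBiorthogonal v u w')
    (hvu : Submodule.span ℝ (Set.range v) ⊔ Submodule.span ℝ (Set.range u) = ⊤) : w = w' := by
  rw [← Submodule.span_union, ← Set.Sum.elim_range] at hvu
  refine funext fun m => (dotProductEquiv ℝ (Fin M)).injective (LinearMap.ext_on_range hvu ?_)
  rintro (n | m')
  · exact (h.1 m n).trans (h'.1 m n).symm
  · exact (h.2 m m').trans (h'.2 m m').symm

theorem IsBiorthogonal.mem_span (h : IsBiorthogonal v u w)
    (hvu : Submodule.span ℝ (Set.range v) ⊔ Submodule.span ℝ (Set.range u) = ⊤)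
    {z : Fin M → ℝ} (hz : ∀ m, w m ⬝ᵥ z = 0) : z ∈ Submodule.span ℝ (Set.range v) := by
  have hmem : z ∈ Submodule.span ℝ (Set.range v) ⊔ Submodule.span ℝ (Set.range u) :=
    hvu ▸ Submodule.mem_top
  obtain ⟨_, ha, _, hb, rfl⟩ := Submodule.mem_sup.1 hmem
  obtain ⟨d, rfl⟩ := (Submodule.mem_span_range_iff_exists_fun ℝ).1 ha
  obtain ⟨c, rfl⟩ := (Submodule.mem_span_range_iff_exists_fun ℝ).1 hb
  have hc : c = 0 := by
    ext m
    simpa [dotProduct_add, dotProduct_sum, dotProduct_smul, h.1, h.2] using hz m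
  simpa [hc] using ha

theorem IsBiorthogonal.linearIndependent (h : IsBiorthogonal v u w) : LinearIndependent ℝ w := by
  rw [Fintype.linearIndependent_iff]
  intro c hc m
  simpa [sum_dotProduct, smul_dotProduct, h.2] using congrArg (· ⬝ᵥ u m) hc

theorem exists_isBiorthogonal (hK : N₀ + K = M)
    (hvu : Submodule.span ℝ (Set.range v) ⊔ Submodule.span ℝ (Set.range u) = ⊤) :
    ∃ w, IsBiorthogonal v u w := by
  have htop : ⊤ ≤ Submodule.span ℝ (Set.range (Sum.elim v u)) := by
    rw [Set.Sum.elim_range, Submodule.span_union, hvu]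
  let B := basisOfTopLeSpanOfCardEqFinrank (Sum.elim v u) htop (by simp [hK])
  have hB : ⇑B = Sum.elim v u := coe_basisOfTopLeSpanOfCardEqFinrank _ _ _
  refine ⟨fun m => (dotProductEquiv ℝ (Fin M)).symm (B.coord (Sum.inr m)), ?_⟩
  have hdot : ∀ m i, (dotProductEquiv ℝ (Fin M)).symm (B.coord (Sum.inr m)) ⬝ᵥ Sum.elim v u i =
      if Sum.inr m = i then 1 else 0 := fun m i => by
    rw [← dotProductEquiv_apply_apply, LinearEquiv.apply_symm_apply, ← hB, Module.Basis.coord_apply,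
      Module.Basis.repr_self, Finsupp.single_apply]
    simp only [eq_comm]
  exact ⟨fun m n => by simpa using hdot m (Sum.inl n), fun m m' => by
    simpa using hdot m (Sum.inr m')⟩

end Biorthogonal

/-! ### Convex functions on the half-line -/

section Regularizer

theorem tendsto_atTop_of_convexOn_of_lt {φ : ℝ → ℝ} (hφ : ConvexOn ℝ Set.univ φ) {a b : ℝ}
    (hab : a < b) (hlt : φ a < φ b) : Filter.Tendsto φ Filter.atTop Filter.atTop := by
  have hline : Filter.Tendsto (fun x => (φ b - φ a) / (b - a) * (x + -a) + φ a)
      Filter.atTop Filter.atTop :=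
    Filter.tendsto_atTop_add_const_right _ _ ((Filter.tendsto_atTop_add_const_right _ _
      Filter.tendsto_id).const_mul_atTop (div_pos (sub_pos.2 hlt) (sub_pos.2 hab)))
  refine Filter.tendsto_atTop_mono' _ ?_ hline
  filter_upwards [Filter.eventually_ge_atTop b] with x hx
  have hax : 0 < x - a := sub_pos.2 (hab.trans_le hx)
  have hsecant := hφ.secant_mono (Set.mem_univ a) (Set.mem_univ b) (Set.mem_univ x) hab.ne'
    (hab.trans_le hx).ne' hx
  rw [le_div_iff₀ hax] at hsecant
  simpa [sub_eq_add_neg, le_sub_iff_add_le] using hsecant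

variable {ψ : ℝ≥0 → ℝ≥0}

theorem convexOn_comp_toNNReal (hmono : Monotone ψ) (hconv : ConvexOn ℝ≥0 Set.univ ψ) :
    ConvexOn ℝ Set.univ fun x : ℝ => (ψ x.toNNReal : ℝ) := by
  refine ⟨convex_univ, fun x _ y _ a b ha hb hab => ?_⟩
  lift a to ℝ≥0 using ha
  lift b to ℝ≥0 using hb
  have hle : ((a : ℝ) • x + (b : ℝ) • y).toNNReal ≤ a • x.toNNReal + b • y.toNNReal := by
    rw [Real.toNNReal_le_iff_le_coe]
    push_cast [smul_eq_mul]
    gcongr <;> exact Real.le_coe_toNNReal _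
  exact_mod_cast (hmono hle).trans
    (hconv.2 (Set.mem_univ x.toNNReal) (Set.mem_univ y.toNNReal) a.2 b.2 (by exact_mod_cast hab))

theorem continuous_of_monotone_of_convexOn (hmono : Monotone ψ)
    (hconv : ConvexOn ℝ≥0 Set.univ ψ) : Continuous ψ := by
  have hext : Continuous fun x : ℝ => (ψ x.toNNReal : ℝ) :=
    continuousOn_univ.1 ((convexOn_comp_toNNReal hmono hconv).continuousOn isOpen_univ)
  simpa [Function.comp_def] using
    continuous_real_toNNReal.comp (hext.comp NNReal.continuous_coe)

theorem tendsto_atTop_of_strictMono_of_convexOn (hmono : StrictMono ψ)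
    (hconv : ConvexOn ℝ≥0 Set.univ ψ) : Filter.Tendsto ψ Filter.atTop Filter.atTop := by
  have hlt : (ψ (0 : ℝ).toNNReal : ℝ) < ψ (1 : ℝ).toNNReal :=
    NNReal.coe_lt_coe.2 (hmono (by simp))
  have hext := tendsto_atTop_of_convexOn_of_lt (convexOn_comp_toNNReal hmono.monotone hconv)
    zero_lt_one hlt
  have hcomp := hext.comp (NNReal.tendsto_coe_atTop.2 Filter.tendsto_id)
  simpa [Function.comp_def, NNReal.tendsto_coe_atTop] using hcomp

end Regularizer

/-! ### Existence of solutions -/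

section Existence

variable {X U : Type*} [NormedAddCommGroup X] [NormedSpace ℝ X] [NormedAddCommGroup U]
  [NormedSpace ℝ U] {N₀ M : ℕ} {D : SplitPair X U N₀} {ν : Fin M → X}
  {E : (Fin M → ℝ) → (Fin M → ℝ) → ℝ≥0∞} {ψ : ℝ≥0 → ℝ≥0} {y : Fin M → ℝ} {f g : StrongDual ℝ X}

theorem semiNorm_convexOn : ConvexOn ℝ≥0 Set.univ D.semiNorm := by
  refine ⟨convex_univ, fun f _ g _ a b _ _ _ => ?_⟩
  calc ‖(a : ℝ) • D.dualProj f + (b : ℝ) • D.dualProj g‖₊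
      ≤ ‖(a : ℝ) • D.dualProj f‖₊ + ‖(b : ℝ) • D.dualProj g‖₊ := nnnorm_add_le _ _
    _ = a • D.semiNorm f + b • D.semiNorm g := by
      rw [nnnorm_smul, nnnorm_smul, NNReal.nnnorm_eq, NNReal.nnnorm_eq]; rfl

theorem regularizer_convexOn (hmono : Monotone ψ) (hconv : ConvexOn ℝ≥0 Set.univ ψ) :
    ConvexOn ℝ≥0 Set.univ fun f : StrongDual ℝ X => (ψ (D.semiNorm f) : ℝ≥0∞) := by
  refine ⟨convex_univ, fun f _ g _ a b ha hb hab => ?_⟩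
  have hle : ψ (D.semiNorm (a • f + b • g)) ≤ a • ψ (D.semiNorm f) + b • ψ (D.semiNorm g) :=
    (hmono (semiNorm_convexOn.2 (Set.mem_univ f) (Set.mem_univ g) ha hb hab)).trans
      (hconv.2 (Set.mem_univ _) (Set.mem_univ _) ha hb hab)
  simpa [ENNReal.smul_def] using ENNReal.coe_le_coe.2 hle

theorem objective_convexOn (hE : ConvexOn ℝ≥0 Set.univ (E y)) (hmono : Monotone ψ)
    (hconv : ConvexOn ℝ≥0 Set.univ ψ) : ConvexOn ℝ≥0 Set.univ (objective D ν E ψ y) := by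
  have hdata : ConvexOn ℝ≥0 Set.univ fun f => E y (measure ν f) :=
    ⟨convex_univ, fun f _ g _ a b ha hb hab =>
      hE.2 (Set.mem_univ (measure ν f)) (Set.mem_univ (measure ν g)) ha hb hab⟩
  exact hdata.add (regularizer_convexOn hmono hconv)

theorem solutionSet_convex (hE : ConvexOn ℝ≥0 Set.univ (E y)) (hmono : Monotone ψ)
    (hconv : ConvexOn ℝ≥0 Set.univ ψ) : Convex ℝ (solutionSet D ν E ψ y) := by
  intro f hf g hg a b ha hb hab h
  lift a to ℝ≥0 using ha
  lift b to ℝ≥0 using hb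
  have hab' : a + b = 1 := by exact_mod_cast hab
  calc objective D ν E ψ y (a • f + b • g)
      ≤ a • objective D ν E ψ y f + b • objective D ν E ψ y g :=
        (objective_convexOn hE hmono hconv).2 (Set.mem_univ f) (Set.mem_univ g) a.2 b.2 hab'
    _ ≤ a • objective D ν E ψ y h + b • objective D ν E ψ y h := by
        gcongr
        · exact hf h
        · exact hg h
    _ = objective D ν E ψ y h := by rw [← add_smul, hab', one_smul]

theorem semiNorm_lowerSemicontinuous :
    LowerSemicontinuous fun f : WeakDual ℝ X => D.semiNorm (WeakDual.toStrongDual f) := by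
  rw [lowerSemicontinuous_iff_isClosed_preimage]
  intro r
  have hpreimage : (fun f : WeakDual ℝ X => D.semiNorm (WeakDual.toStrongDual f)) ⁻¹' Set.Iic r =
      ⋂ u : U, {f : WeakDual ℝ X | ‖f (D.incl u)‖ ≤ r * ‖u‖} := by
    ext f
    rw [Set.mem_preimage, Set.mem_Iic, Set.mem_iInter]
    exact ContinuousLinearMap.opNorm_le_iff (f := D.dualProj (WeakDual.toStrongDual f)) r.2
  rw [hpreimage]
  exact isClosed_iInter fun u =>
    isClosed_le (WeakDual.eval_continuous (D.incl u)).norm continuous_const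

theorem objective_lowerSemicontinuous (hE : LowerSemicontinuous (E y)) (hmono : Monotone ψ)
    (hcont : Continuous ψ) :
    LowerSemicontinuous fun f : WeakDual ℝ X => objective D ν E ψ y (WeakDual.toStrongDual f) := by
  have hmeasure : Continuous fun f : WeakDual ℝ X => measure ν (WeakDual.toStrongDual f) :=
    continuous_pi fun m => WeakDual.eval_continuous (ν m)
  exact (hE.comp hmeasure).add (ENNReal.continuous_coe.comp_lowerSemicontinuous
    (hcont.comp_lowerSemicontinuous semiNorm_lowerSemicontinuous hmono) ENNReal.coe_mono)

theorem exists_objective_ne_top (hν : LinearIndependent ℝ ν) (hE : ∃ z, E y z ≠ ⊤) :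
    ∃ f, objective D ν E ψ y f ≠ ⊤ := by
  obtain ⟨z, hz⟩ := hE
  obtain ⟨f, rfl⟩ := measure_surjective hν z
  exact ⟨f, ENNReal.add_ne_top.2 ⟨hz, ENNReal.coe_ne_top⟩⟩

theorem objective_ne_top_of_mem_solutionSet (hfin : ∃ f, objective D ν E ψ y f ≠ ⊤)
    (hf : f ∈ solutionSet D ν E ψ y) : objective D ν E ψ y f ≠ ⊤ :=
  hfin.elim fun g hg => ne_top_of_le_ne_top hg (hf g)

theorem apply_measure_ne_top_of_mem_solutionSet (hfin : ∃ f, objective D ν E ψ y f ≠ ⊤)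
    (hf : f ∈ solutionSet D ν E ψ y) : E y (measure ν f) ≠ ⊤ :=
  (ENNReal.add_ne_top.1 (objective_ne_top_of_mem_solutionSet hfin hf)).1

variable [CompleteSpace X] [CompleteSpace U]

theorem isBounded_sublevel (hv : LinearIndependent ℝ (crossVec D ν))
    (hE : Filter.Tendsto (E y) (Filter.cocompact (Fin M → ℝ)) (𝓝 ⊤))
    (hψ : Filter.Tendsto ψ Filter.atTop Filter.atTop) {c : ℝ≥0∞} (hc : c ≠ ⊤) :
    Bornology.IsBounded {f | objective D ν E ψ y f ≤ c} := by
  lift c to ℝ≥0 using hc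
  obtain ⟨r, hr⟩ := Filter.eventually_atTop.1 (hψ.eventually_gt_atTop c)
  obtain ⟨C, hC, hCE⟩ := Filter.mem_cocompact.1
    (hE.eventually (lt_mem_nhds ENNReal.coe_lt_top))
  refine (isBounded_setOf_dualProj_mem_measure_mem hv
    (Metric.isBounded_closedBall (x := (0 : StrongDual ℝ U)) (r := r)) hC.isBounded).subset
    fun f hf => ⟨mem_closedBall_zero_iff.2 (le_of_not_ge fun hlt => ?_), ?_⟩
  · exact (hr _ hlt).not_ge (ENNReal.coe_le_coe.1 (le_add_self.trans hf))
  · by_contra hn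
    have hlt : c < E y (measure ν f) := hCE hn
    exact hlt.not_ge (le_self_add.trans hf)

theorem isCompact_sublevel (hv : LinearIndependent ℝ (crossVec D ν))
    (hE_lsc : LowerSemicontinuous (E y))
    (hE : Filter.Tendsto (E y) (Filter.cocompact (Fin M → ℝ)) (𝓝 ⊤)) (hmono : Monotone ψ)
    (hcont : Continuous ψ) (hψ : Filter.Tendsto ψ Filter.atTop Filter.atTop) {c : ℝ≥0∞}
    (hc : c ≠ ⊤) :
    IsCompact {f : WeakDual ℝ X | objective D ν E ψ y (WeakDual.toStrongDual f) ≤ c} :=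
  WeakDual.isCompact_of_bounded_of_closed
    (isBounded_sublevel (D := D) (ν := ν) hv hE hψ hc)
    ((objective_lowerSemicontinuous hE_lsc hmono hcont).isClosed_preimage c)

theorem solutionSet_nonempty (hv : LinearIndependent ℝ (crossVec D ν))
    (hfin : ∃ f, objective D ν E ψ y f ≠ ⊤) (hE_lsc : LowerSemicontinuous (E y))
    (hE : Filter.Tendsto (E y) (Filter.cocompact (Fin M → ℝ)) (𝓝 ⊤)) (hmono : Monotone ψ)
    (hcont : Continuous ψ) (hψ : Filter.Tendsto ψ Filter.atTop Filter.atTop) :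
    (solutionSet D ν E ψ y).Nonempty := by
  obtain ⟨f₁, hf₁⟩ := hfin
  obtain ⟨f, hf, hmin⟩ := LowerSemicontinuousOn.exists_isMinOn
    ⟨StrongDual.toWeakDual f₁, le_refl (objective D ν E ψ y f₁)⟩
    (isCompact_sublevel (D := D) (ν := ν) hv hE_lsc hE hmono hcont hψ hf₁)
    ((objective_lowerSemicontinuous (D := D) (ν := ν) hE_lsc hmono hcont).lowerSemicontinuousOn _)
  refine ⟨WeakDual.toStrongDual f, fun g => ?_⟩
  obtain hg | hg := le_total (objective D ν E ψ y g) (objective D ν E ψ y f₁)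
  · exact hmin (a := StrongDual.toWeakDual g) hg
  · exact le_trans hf hg

theorem solutionSet_isCompact (hv : LinearIndependent ℝ (crossVec D ν))
    (hfin : ∃ f, objective D ν E ψ y f ≠ ⊤) (hE_lsc : LowerSemicontinuous (E y))
    (hE : Filter.Tendsto (E y) (Filter.cocompact (Fin M → ℝ)) (𝓝 ⊤)) (hmono : Monotone ψ)
    (hcont : Continuous ψ) (hψ : Filter.Tendsto ψ Filter.atTop Filter.atTop) :
    IsCompact (StrongDual.toWeakDual '' solutionSet D ν E ψ y) := by
  obtain ⟨f₀, hf₀⟩ := solutionSet_nonempty hv hfin hE_lsc hE hmono hcont hψ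
  convert isCompact_sublevel (D := D) (ν := ν) hv hE_lsc hE hmono hcont hψ
    (objective_ne_top_of_mem_solutionSet hfin hf₀) using 1
  ext f
  constructor
  · rintro ⟨g, hg, rfl⟩
    exact hg f₀
  · exact fun hf => ⟨WeakDual.toStrongDual f, fun g => le_trans hf (hf₀ g), rfl⟩

end Existence

theorem toWeakDual_image_eq_closure_convexHull {X : Type*} [NormedAddCommGroup X]
    [NormedSpace ℝ X] {S : Set (StrongDual ℝ X)} (hcv : Convex ℝ S)
    (hcp : IsCompact (StrongDual.toWeakDual '' S)) :
    StrongDual.toWeakDual '' S =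
      closure (convexHull ℝ (StrongDual.toWeakDual '' S.extremePoints ℝ)) := by
  have : LocallyConvexSpace ℝ (WeakDual ℝ X) := (WeakDual.withSeminorms ℝ X).toLocallyConvexSpace
  rw [image_extremePoints, closure_convexHull_extremePoints hcp]
  exact hcv.linear_image (StrongDual.toWeakDual (𝕜 := ℝ) (E := X)).toLinearMap

/-! ### Structure of the solution set -/

section Structure

variable {X U : Type*} [NormedAddCommGroup X] [NormedSpace ℝ X] [NormedAddCommGroup U]
  [NormedSpace ℝ U] {N₀ M K : ℕ} {D : SplitPair X U N₀} {ν : Fin M → X}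
  {E : (Fin M → ℝ) → (Fin M → ℝ) → ℝ≥0∞} {ψ : ℝ≥0 → ℝ≥0} {y : Fin M → ℝ} {f g : StrongDual ℝ X}
  {u w : Fin K → Fin M → ℝ} {ν' : Fin K → U}

theorem objective_midpoint_lt (hE : ExtStrictConvex (E y)) (hmono : Monotone ψ)
    (hconv : ConvexOn ℝ≥0 Set.univ ψ) (hf : E y (measure ν f) ≠ ⊤) (hg : E y (measure ν g) ≠ ⊤)
    (hfg : measure ν f ≠ measure ν g) :
    objective D ν E ψ y ((1 / 2 : ℝ≥0) • f + (1 / 2 : ℝ≥0) • g) <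
      (1 / 2 : ℝ≥0) • objective D ν E ψ y f + (1 / 2 : ℝ≥0) • objective D ν E ψ y g := by
  have hhalf : (0 : ℝ≥0) < 1 / 2 := by positivity
  have hsum : (1 / 2 : ℝ≥0) + 1 / 2 = 1 := add_halves 1
  calc objective D ν E ψ y ((1 / 2 : ℝ≥0) • f + (1 / 2 : ℝ≥0) • g)
      < ((1 / 2 : ℝ≥0) • E y (measure ν f) + (1 / 2 : ℝ≥0) • E y (measure ν g)) +
        ((1 / 2 : ℝ≥0) • (ψ (D.semiNorm f) : ℝ≥0∞) +
          (1 / 2 : ℝ≥0) • (ψ (D.semiNorm g) : ℝ≥0∞)) :=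
        ENNReal.add_lt_add_of_lt_of_le ENNReal.coe_ne_top (hE.2 hf hg hfg hhalf hhalf hsum)
          ((regularizer_convexOn hmono hconv).2 (Set.mem_univ f) (Set.mem_univ g)
            hhalf.le hhalf.le hsum)
    _ = (1 / 2 : ℝ≥0) • objective D ν E ψ y f + (1 / 2 : ℝ≥0) • objective D ν E ψ y g := by
        simp only [objective, smul_add]
        abel

theorem measure_eq_of_mem_solutionSet (hfin : ∃ f, objective D ν E ψ y f ≠ ⊤)
    (hE : ExtStrictConvex (E y) ∨ ∀ z, z ≠ y → E y z = ⊤) (hmono : Monotone ψ)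
    (hconv : ConvexOn ℝ≥0 Set.univ ψ) (hf : f ∈ solutionSet D ν E ψ y)
    (hg : g ∈ solutionSet D ν E ψ y) : measure ν f = measure ν g := by
  have hEf := apply_measure_ne_top_of_mem_solutionSet hfin hf
  have hEg := apply_measure_ne_top_of_mem_solutionSet hfin hg
  obtain hE | hE := hE
  · by_contra hne
    refine (objective_midpoint_lt (D := D) hE hmono hconv hEf hEg hne).not_ge ?_
    rw [(hf g).antisymm (hg f), ← add_smul, add_halves, one_smul]
    exact hg _
  · exact (not_imp_comm.1 (hE _) hEf).trans (not_imp_comm.1 (hE _) hEg).symm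

theorem semiNorm_le_of_mem_solutionSet (hfin : ∃ f, objective D ν E ψ y f ≠ ⊤)
    (hmono : StrictMono ψ) (hf : f ∈ solutionSet D ν E ψ y)
    (hfg : measure ν f = measure ν g) : D.semiNorm f ≤ D.semiNorm g := by
  have hle := hf g
  rwa [objective, objective, ← hfg,
    ENNReal.add_le_add_iff_left (apply_measure_ne_top_of_mem_solutionSet hfin hf),
    ENNReal.coe_le_coe, hmono.le_iff_le] at hle

theorem mem_solutionSet_of_semiNorm_le (hmono : Monotone ψ) (hf : f ∈ solutionSet D ν E ψ y)
    (hgf : measure ν g = measure ν f) (hle : D.semiNorm g ≤ D.semiNorm f) :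
    g ∈ solutionSet D ν E ψ y := by
  refine fun h => le_trans ?_ (hf h)
  rw [objective, objective, hgf]
  gcongr
  exact hmono hle

theorem exists_reduced_basis (hν : LinearIndependent ℝ ν)
    (hw : IsBiorthogonal (crossVec D ν) u w) :
    ∃ ν' : Fin K → U, (∀ m, D.incl (ν' m) = ∑ j, w m j • ν j) ∧ LinearIndependent ℝ ν' := by
  choose ν' hν' using fun m => D.exists_incl_eq fun n =>
    (dotProduct_measure (w m) (D.p n)).symm.trans (hw.1 m n)
  have hcomp : D.incl.toLinearMap ∘ ν' = Fintype.linearCombination ℝ ν ∘ w := funext hν'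
  refine ⟨ν', hν', LinearIndependent.of_comp D.incl.toLinearMap ?_⟩
  rw [hcomp]
  exact hw.linearIndependent.map' (Fintype.linearCombination ℝ ν)
    (LinearMap.ker_eq_bot.2 hν.fintypeLinearCombination_injective)

theorem dualProj_apply_eq_dotProduct_measure (hν' : ∀ m, D.incl (ν' m) = ∑ j, w m j • ν j)
    (f : StrongDual ℝ X) (m : Fin K) : D.dualProj f (ν' m) = w m ⬝ᵥ measure ν f := by
  rw [D.dualProj_apply, hν', dotProduct_measure]

variable [CompleteSpace X] [CompleteSpace U]

theorem exists_dualProj_eq_of_forall_apply_eq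
    (hu : Submodule.span ℝ (Set.range (crossVec D ν)) ⊔ Submodule.span ℝ (Set.range u) = ⊤)
    (hw : IsBiorthogonal (crossVec D ν) u w) (hν' : ∀ m, D.incl (ν' m) = ∑ j, w m j • ν j)
    {s : StrongDual ℝ U} {z : Fin M → ℝ} (hs : ∀ m, s (ν' m) = w m ⬝ᵥ z) :
    ∃ f, D.dualProj f = s ∧ measure ν f = z := by
  refine exists_dualProj_eq_measure_eq (hw.mem_span hu fun m => ?_)
  rw [dotProduct_sub, ← dualProj_apply_eq_dotProduct_measure hν', D.dualProj_dualIncl, hs, sub_self]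

theorem exists_common_dualityMap
    (hu : Submodule.span ℝ (Set.range (crossVec D ν)) ⊔ Submodule.span ℝ (Set.range u) = ⊤)
    (hw : IsBiorthogonal (crossVec D ν) u w) (hν' : ∀ m, D.incl (ν' m) = ∑ j, w m j • ν j)
    (hfin : ∃ f, objective D ν E ψ y f ≠ ⊤) (hmono : StrictMono ψ)
    (hS : (solutionSet D ν E ψ y).Nonempty)
    (hconst : ∀ f ∈ solutionSet D ν E ψ y, ∀ g ∈ solutionSet D ν E ψ y,
      measure ν f = measure ν g) :
    ∃ a : Fin K → ℝ, ∀ f ∈ solutionSet D ν E ψ y, D.dualProj f ∈ dualityMap (∑ m, a m • ν' m) := by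
  obtain ⟨f₁, hf₁⟩ := hS
  obtain ⟨a, ha⟩ := exists_mem_dualityMap_sum_smul ν' (s := D.dualProj f₁) fun t ht => by
    obtain ⟨g, rfl, hg⟩ := exists_dualProj_eq_of_forall_apply_eq hu hw hν' fun m =>
      (ht m).trans (dualProj_apply_eq_dotProduct_measure hν' f₁ m)
    exact semiNorm_le_of_mem_solutionSet hfin hmono hf₁ hg.symm
  refine ⟨a, fun f hf => mem_dualityMap_iff.2 ?_⟩
  have hmeasure := hconst f hf f₁ hf₁
  obtain ⟨hnorm, hnorming⟩ := mem_dualityMap_iff.1 ha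
  refine ⟨le_trans (semiNorm_le_of_mem_solutionSet hfin hmono hf hmeasure) hnorm,
    hnorming.trans_eq ?_⟩
  simp only [map_sum, map_smul, dualProj_apply_eq_dotProduct_measure hν', hmeasure]

theorem eq_zero_of_mem_faceDirection_dualityMap
    (hu : Submodule.span ℝ (Set.range (crossVec D ν)) ⊔ Submodule.span ℝ (Set.range u) = ⊤)
    (hw : IsBiorthogonal (crossVec D ν) u w) (hν' : ∀ m, D.incl (ν' m) = ∑ j, w m j • ν j)
    (hmono : Monotone ψ) (hcv : Convex ℝ (solutionSet D ν E ψ y))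
    (hf : f ∈ (solutionSet D ν E ψ y).extremePoints ℝ) {u₀ : U}
    (hJ : D.dualProj f ∈ dualityMap u₀) {d : StrongDual ℝ U}
    (hd : d ∈ faceDirection (dualityMap_convex u₀) hJ) (hdν' : ∀ m, d (ν' m) = 0) : d = 0 := by
  obtain ⟨h, rfl, hh⟩ := exists_dualProj_eq_of_forall_apply_eq hu hw hν' (z := 0) fun m => by
    rw [hdν', dotProduct_zero]
  have hface : h ∈ faceDirection hcv hf.1 := hd.mono fun t ht => by
    refine mem_solutionSet_of_semiNorm_le hmono hf.1 ?_ (ht.1.trans hJ.1.symm).le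
    simp only [← coe_measureL, map_add, map_smul] at hh ⊢
    rw [hh, smul_zero, add_zero]
  rw [(mem_extremePoints_iff_faceDirection_eq_bot hcv hf.1).1 hf, Submodule.mem_bot] at hface
  rw [hface, ← D.coe_dualProjL, map_zero]

theorem exists_extremePoint_representation
    (hu : Submodule.span ℝ (Set.range (crossVec D ν)) ⊔ Submodule.span ℝ (Set.range u) = ⊤)
    (hw : IsBiorthogonal (crossVec D ν) u w) (hν' : ∀ m, D.incl (ν' m) = ∑ j, w m j • ν j)
    (hmono : Monotone ψ) (hcv : Convex ℝ (solutionSet D ν E ψ y))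
    (hf : f ∈ (solutionSet D ν E ψ y).extremePoints ℝ) {a : Fin K → ℝ}
    (hJ : D.dualProj f ∈ dualityMap (∑ m, a m • ν' m)) :
    ∃ K₀ ≤ K, ∃ (c : Fin K₀ → ℝ) (e : Fin K₀ → StrongDual ℝ U) (b : Fin N₀ → ℝ),
      (∀ k, e k ∈ (Metric.closedBall (0 : StrongDual ℝ U) 1).extremePoints ℝ) ∧
      f = ∑ k, c k • D.dualIncl (e k) + ∑ n, b n • D.p n := by
  obtain ⟨K₀, hK₀, c, e, he, hce⟩ := exists_sum_smul_extremePoints_closedBall hJ fun _ =>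
    eq_zero_of_mem_faceDirection_dualityMap hu hw hν' hmono hcv hf hJ
  refine ⟨K₀, hK₀.trans_eq (Fintype.card_fin K), c, e, fun n => f (D.pstar n), he, ?_⟩
  rw [← D.dualIncl_sum_smul, ← hce]
  exact D.eq_dualIncl_add_sum f

variable {S : Set (StrongDual ℝ X)}

theorem exists_unique_null_coefficients (hS : S.Nonempty)
    (hconst : ∀ f ∈ S, ∀ g ∈ S, measure ν f = measure ν g)
    (hp : Submodule.span ℝ (Set.range D.pstar) ≤ Submodule.span ℝ (Set.range ν)) :
    ∃! b : Fin N₀ → ℝ, ∀ f₀ ∈ S, ∃ s₀ : StrongDual ℝ U,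
      f₀ = D.dualIncl s₀ + ∑ n, b n • D.p n := by
  obtain ⟨f₁, hf₁⟩ := hS
  refine ⟨fun n => f₁ (D.pstar n), fun f₀ hf₀ => ⟨D.dualProj f₀, ?_⟩, fun b hb => ?_⟩
  · have hpstar : ∀ n, f₁ (D.pstar n) = f₀ (D.pstar n) := fun n => by
      obtain ⟨c, hc⟩ := (Submodule.mem_span_range_iff_exists_fun ℝ).1
        (hp (Submodule.subset_span (Set.mem_range_self n)))
      rw [← hc, ← dotProduct_measure, ← dotProduct_measure, hconst f₁ hf₁ f₀ hf₀]
    simp only [hpstar]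
    exact D.eq_dualIncl_add_sum f₀
  · obtain ⟨s, hs⟩ := hb f₁ hf₁
    exact (D.eq_of_eq_dualIncl_add_sum hs).2

theorem exists_eq_singleton_of_forall_mem_dualityMap [StrictConvexSpace ℝ (StrongDual ℝ U)]
    (hS : S.Nonempty) (hconst : ∀ f ∈ S, ∀ g ∈ S, measure ν f = measure ν g)
    (hv : LinearIndependent ℝ (crossVec D ν)) {u₀ : U}
    (hJ : ∀ f ∈ S, D.dualProj f ∈ dualityMap u₀) {s : StrongDual ℝ U} (hs : s ∈ dualityMap u₀) :
    ∃ (f₀ : StrongDual ℝ X) (b : Fin N₀ → ℝ), S = {f₀} ∧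
      f₀ = D.dualIncl s + ∑ n, b n • D.p n := by
  obtain ⟨f₀, hf₀⟩ := hS
  refine ⟨f₀, fun n => f₀ (D.pstar n), Set.eq_singleton_iff_unique_mem.2 ⟨hf₀, fun f hf => ?_⟩, ?_⟩
  · exact eq_of_dualProj_eq_of_measure_eq hv
      (dualityMap_subsingleton u₀ (hJ f hf) (hJ f₀ hf₀)) (hconst f hf f₀ hf₀)
  · rw [dualityMap_subsingleton u₀ hs (hJ f₀ hf₀)]
    exact D.eq_dualIncl_add_sum f₀

theorem exists_dualityOperator_eq_singleton [StrictConvexSpace ℝ (StrongDual ℝ U)]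
    (hS : S.Nonempty) (hconst : ∀ f ∈ S, ∀ g ∈ S, measure ν f = measure ν g)
    (hv : LinearIndependent ℝ (crossVec D ν)) {u₀ : U}
    (hJ : ∀ f ∈ S, D.dualProj f ∈ dualityMap u₀) :
    ∃ J : U → StrongDual ℝ U, IsDualityOperator J ∧
      ∃ (f₀ : StrongDual ℝ X) (b : Fin N₀ → ℝ), S = {f₀} ∧
        f₀ = D.dualIncl (J u₀) + ∑ n, b n • D.p n := by
  obtain ⟨J, hJop⟩ := exists_isDualityOperator (U := U)
  exact ⟨J, hJop, exists_eq_singleton_of_forall_mem_dualityMap hS hconst hv hJ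
    (hJop u₀ ▸ Set.mem_singleton _)⟩

theorem exists_rieszMap_eq_singleton [InnerProductSpaceable (StrongDual ℝ U)]
    (hS : S.Nonempty) (hconst : ∀ f ∈ S, ∀ g ∈ S, measure ν f = measure ν g)
    (hv : LinearIndependent ℝ (crossVec D ν)) {a : Fin K → ℝ}
    (hJ : ∀ f ∈ S, D.dualProj f ∈ dualityMap (∑ m, a m • ν' m)) :
    ∃ R : U ≃ₗᵢ[ℝ] StrongDual ℝ U, IsRieszMap R ∧
      ∃ (f₀ : StrongDual ℝ X) (b : Fin N₀ → ℝ), S = {f₀} ∧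
        f₀ = ∑ m, a m • D.dualIncl (R (ν' m)) + ∑ n, b n • D.p n := by
  obtain ⟨R, hR⟩ := exists_isRieszMap_of_dual (U := U)
  have hsum : R (∑ m, a m • ν' m) = ∑ m, a m • R (ν' m) := by simp only [map_sum, map_smul]
  refine ⟨R, hR, ?_⟩
  simpa only [hsum, D.dualIncl_sum_smul] using
    exists_eq_singleton_of_forall_mem_dualityMap hS hconst hv hJ (hR.mem_dualityMap _)

end Structure

end SemiNormRep

open SemiNormRep in
theorem theorem3_general {X U : Type*} [NormedAddCommGroup X] [NormedSpace ℝ X] [CompleteSpace X]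
    [NormedAddCommGroup U] [NormedSpace ℝ U] [CompleteSpace U]
    {N₀ M : ℕ} (D : SplitPair X U N₀)
    (ν : Fin M → X) (hν : LinearIndependent ℝ ν)
    (hv : LinearIndependent ℝ (crossVec D ν))
    (u : Fin (M - N₀) → Fin M → ℝ)
    (hu : IsCompl (Submodule.span ℝ (Set.range (crossVec D ν))) (Submodule.span ℝ (Set.range u)))
    (E : (Fin M → ℝ) → (Fin M → ℝ) → ℝ≥0∞) (y : Fin M → ℝ)
    (hE_proper : ∃ z, E y z ≠ ⊤)
    (hE_lsc : LowerSemicontinuous (E y))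
    (hE_coercive : Filter.Tendsto (E y) (Filter.cocompact (Fin M → ℝ)) (𝓝 ⊤))
    (hE_convex : ConvexOn ℝ≥0 Set.univ (E y))
    (ψ : ℝ≥0 → ℝ≥0) (hψ_mono : StrictMono ψ) (hψ_convex : ConvexOn ℝ≥0 Set.univ ψ) :
    ((solutionSet D ν E ψ y).Nonempty ∧
      Convex ℝ (solutionSet D ν E ψ y) ∧
      IsCompact (StrongDual.toWeakDual '' solutionSet D ν E ψ y)) ∧
    (∃! w : Fin (M - N₀) → Fin M → ℝ, IsBiorthogonal (crossVec D ν) u w) ∧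
    ∀ w : Fin (M - N₀) → Fin M → ℝ, IsBiorthogonal (crossVec D ν) u w →
    ∃ ν' : Fin (M - N₀) → U,
      (∀ m, D.incl (ν' m) = ∑ j, w m j • ν j) ∧ LinearIndependent ℝ ν' ∧
      (ExtStrictConvex (E y) ∨ (∀ z, z ≠ y → E y z = ⊤) →
        ∃ a : Fin (M - N₀) → ℝ,
          (∀ f₀ ∈ solutionSet D ν E ψ y, ∃ p₀ ∈ D.nullSpace, ∃ s₀ ∈ dualityMap (∑ m, a m • ν' m),
            f₀ = p₀ + D.dualIncl s₀ ∧
            ∀ p₁ ∈ D.nullSpace, ∀ s₁ : StrongDual ℝ U,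
              f₀ = p₁ + D.dualIncl s₁ → p₁ = p₀ ∧ s₁ = s₀) ∧
          (InnerProductSpaceable (StrongDual ℝ U) →
            ∃ R : U ≃ₗᵢ[ℝ] StrongDual ℝ U, IsRieszMap R ∧
            ∃ (f₀ : StrongDual ℝ X) (b : Fin N₀ → ℝ), solutionSet D ν E ψ y = {f₀} ∧
              f₀ = ∑ m, a m • D.dualIncl (R (ν' m)) + ∑ n, b n • D.p n) ∧
          (StrictConvexSpace ℝ (StrongDual ℝ U) →
            ∃ J : U → StrongDual ℝ U, IsDualityOperator J ∧
            ∃ (f₀ : StrongDual ℝ X) (b : Fin N₀ → ℝ), solutionSet D ν E ψ y = {f₀} ∧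
              f₀ = D.dualIncl (J (∑ m, a m • ν' m)) + ∑ n, b n • D.p n) ∧
          (StrongDual.toWeakDual '' solutionSet D ν E ψ y =
              closure (convexHull ℝ
                (StrongDual.toWeakDual '' (solutionSet D ν E ψ y).extremePoints ℝ)) ∧
            ∀ f₀ ∈ (solutionSet D ν E ψ y).extremePoints ℝ,
              ∃ K₀ ≤ M - N₀, ∃ (c : Fin K₀ → ℝ) (e : Fin K₀ → StrongDual ℝ U) (b : Fin N₀ → ℝ),
                (∀ k, e k ∈ (Metric.closedBall (0 : StrongDual ℝ U) 1).extremePoints ℝ) ∧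
                f₀ = ∑ k, c k • D.dualIncl (e k) + ∑ n, b n • D.p n) ∧
          (Submodule.span ℝ (Set.range D.pstar) ≤ Submodule.span ℝ (Set.range ν) →
            ∃! b : Fin N₀ → ℝ, ∀ f₀ ∈ solutionSet D ν E ψ y, ∃ s₀ : StrongDual ℝ U,
              f₀ = D.dualIncl s₀ + ∑ n, b n • D.p n)) := by
  have hfin := exists_objective_ne_top (D := D) (ψ := ψ) hν hE_proper
  have hcont := continuous_of_monotone_of_convexOn hψ_mono.monotone hψ_convex
  have htend := tendsto_atTop_of_strictMono_of_convexOn hψ_mono hψ_convex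
  have hne := solutionSet_nonempty hv hfin hE_lsc hE_coercive hψ_mono.monotone hcont htend
  have hcv := solutionSet_convex (D := D) (ν := ν) hE_convex hψ_mono.monotone hψ_convex
  have hcp := solutionSet_isCompact hv hfin hE_lsc hE_coercive hψ_mono.monotone hcont htend
  have hcard : N₀ ≤ M := by simpa using hv.fintype_card_le_finrank
  obtain ⟨w₀, hw₀⟩ := exists_isBiorthogonal (Nat.add_sub_of_le hcard) hu.sup_eq_top
  refine ⟨⟨hne, hcv, hcp⟩, ⟨w₀, hw₀, fun w hw => hw.eq hw₀ hu.sup_eq_top⟩, fun w hw => ?_⟩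
  obtain ⟨ν', hν', hli⟩ := exists_reduced_basis hν hw
  refine ⟨ν', hν', hli, fun hE => ?_⟩
  have hconst : ∀ f ∈ solutionSet D ν E ψ y, ∀ g ∈ solutionSet D ν E ψ y,
      measure ν f = measure ν g := fun f hf g hg =>
    measure_eq_of_mem_solutionSet hfin hE hψ_mono.monotone hψ_convex hf hg
  obtain ⟨a, ha⟩ := exists_common_dualityMap hu.sup_eq_top hw hν' hfin hψ_mono hne hconst
  refine ⟨a, fun f₀ hf₀ => ?_, fun _ => exists_rieszMap_eq_singleton hne hconst hv ha,
    fun _ => exists_dualityOperator_eq_singleton hne hconst hv ha,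
    ⟨toWeakDual_image_eq_closure_convexHull hcv hcp, fun f₀ hf₀ => ?_⟩,
    exists_unique_null_coefficients hne hconst⟩
  · obtain ⟨p₀, hp₀, hdecomp, huniq⟩ := D.exists_unique_decomposition f₀
    exact ⟨p₀, hp₀, D.dualProj f₀, ha f₀ hf₀, hdecomp, huniq⟩
  · exact exists_extremePoint_representation hu.sup_eq_top hw hν' hψ_mono.monotone hcv hf₀
      (ha f₀ hf₀.1)

open SemiNormRep in
theorem theorem3 {X U : Type*} [NormedAddCommGroup X] [NormedSpace ℝ X] [CompleteSpace X]
    [NormedAddCommGroup U] [NormedSpace ℝ U] [CompleteSpace U]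
    {N₀ M : ℕ} (hM : N₀ < M) (D : SplitPair X U N₀)
    (ν : Fin M → X) (hν : LinearIndependent ℝ ν)
    (hv : LinearIndependent ℝ (crossVec D ν))
    (u : Fin (M - N₀) → Fin M → ℝ)
    (hu : IsCompl (Submodule.span ℝ (Set.range (crossVec D ν))) (Submodule.span ℝ (Set.range u)))
    (E : (Fin M → ℝ) → (Fin M → ℝ) → ℝ≥0∞) (y : Fin M → ℝ)
    (hE_proper : ∃ z, E y z ≠ ⊤)
    (hE_lsc : LowerSemicontinuous (E y))
    (hE_coercive : Filter.Tendsto (E y) (Filter.cocompact (Fin M → ℝ)) (𝓝 ⊤))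
    (hE_convex : ConvexOn ℝ≥0 Set.univ (E y))
    (ψ : ℝ≥0 → ℝ≥0) (hψ_mono : StrictMono ψ) (hψ_convex : ConvexOn ℝ≥0 Set.univ ψ) :
    -- existence
    ((solutionSet D ν E ψ y).Nonempty ∧
      Convex ℝ (solutionSet D ν E ψ y) ∧
      IsCompact (StrongDual.toWeakDual '' solutionSet D ν E ψ y)) ∧
    -- the reduced basis
    (∃! w : Fin (M - N₀) → Fin M → ℝ, IsBiorthogonal (crossVec D ν) u w) ∧
    ∀ w : Fin (M - N₀) → Fin M → ℝ, IsBiorthogonal (crossVec D ν) u w →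
    ∃ ν' : Fin (M - N₀) → U,
      (∀ m, D.incl (ν' m) = ∑ j, w m j • ν j) ∧ LinearIndependent ℝ ν' ∧
      -- representation of the solutions
      (ExtStrictConvex (E y) ∨ (∀ z, z ≠ y → E y z = ⊤) →
        ∃ a : Fin (M - N₀) → ℝ,
          (∀ f₀ ∈ solutionSet D ν E ψ y, ∃ p₀ ∈ D.nullSpace, ∃ s₀ ∈ dualityMap (∑ m, a m • ν' m),
            f₀ = p₀ + D.dualIncl s₀ ∧
            ∀ p₁ ∈ D.nullSpace, ∀ s₁ : StrongDual ℝ U,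
              f₀ = p₁ + D.dualIncl s₁ → p₁ = p₀ ∧ s₁ = s₀) ∧
          -- `U'` is a Hilbert space
          (InnerProductSpaceable (StrongDual ℝ U) → StrictConvexOn ℝ≥0 Set.univ ψ →
            ∃ R : U ≃ₗᵢ[ℝ] StrongDual ℝ U, IsRieszMap R ∧
            ∃ (f₀ : StrongDual ℝ X) (b : Fin N₀ → ℝ), solutionSet D ν E ψ y = {f₀} ∧
              f₀ = ∑ m, a m • D.dualIncl (R (ν' m)) + ∑ n, b n • D.p n) ∧
          -- `U'` is strictly convex
          (StrictConvexSpace ℝ (StrongDual ℝ U) →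
            ∃ J : U → StrongDual ℝ U, IsDualityOperator J ∧
            ∃ (f₀ : StrongDual ℝ X) (b : Fin N₀ → ℝ), solutionSet D ν E ψ y = {f₀} ∧
              f₀ = D.dualIncl (J (∑ m, a m • ν' m)) + ∑ n, b n • D.p n) ∧
          -- the general case
          (StrongDual.toWeakDual '' solutionSet D ν E ψ y =
              closure (convexHull ℝ
                (StrongDual.toWeakDual '' (solutionSet D ν E ψ y).extremePoints ℝ)) ∧
            ∀ f₀ ∈ (solutionSet D ν E ψ y).extremePoints ℝ,
              ∃ K₀ ≤ M - N₀, ∃ (c : Fin K₀ → ℝ) (e : Fin K₀ → StrongDual ℝ U) (b : Fin N₀ → ℝ),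
                (∀ k, e k ∈ (Metric.closedBall (0 : StrongDual ℝ U) 1).extremePoints ℝ) ∧
                f₀ = ∑ k, c k • D.dualIncl (e k) + ∑ n, b n • D.p n) ∧
          -- uniqueness of the null-space coefficients
          (ExtStrictConvex (E y) →
            Submodule.span ℝ (Set.range D.pstar) ≤ Submodule.span ℝ (Set.range ν) →
            ∃! b : Fin N₀ → ℝ, ∀ f₀ ∈ solutionSet D ν E ψ y, ∃ s₀ : StrongDual ℝ U,
              f₀ = D.dualIncl s₀ + ∑ n, b n • D.p n)) := by
  obtain ⟨hS, hbasis, hrep⟩ := theorem3_general D ν hν hv u hu E y hE_proper hE_lsc hE_coercive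
    hE_convex ψ hψ_mono hψ_convex
  refine ⟨hS, hbasis, fun w hw => ?_⟩
  obtain ⟨ν', hν', hli, hsol⟩ := hrep w hw
  refine ⟨ν', hν', hli, fun hE => ?_⟩
  obtain ⟨a, hdecomp, hHilbert, hstrict, hgeneral, hnull⟩ := hsol hE
  exact ⟨a, hdecomp, fun hH _ => hHilbert hH, hstrict, hgeneral, fun _ => hnull⟩
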